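/- Let $\mathbb{Z}\wr\mathbb{Z}$ be the group of all pairs $(f,x)$, where $x\in\mathbb{Z}$ and $f:\mathbb{Z}\to\mathbb{Z}$ has finite support, equipped with the group law $(f,x)(g,y)=(z\mapsto f(z)+g(z-x),\,x+y)$. For a finitely generated group $G$ with a finite symmetric generating set $S$ (that is, $S^{-1}=S$), let $d$ be the left-invariant word metric on $G$ induced by $S$. The Hilbert compression exponent $\alpha^*(G)$ is the supremum of all $\alpha\ge 0$ for which there exist a mapping $f:G\to L_2$ that is $1$-Lipschitz with respect to $d$ and a constant $c>0$ such that $\|f(x)-f(y)\|_2\ge c\,d(x,y)^\alpha$ for all $x,y\in G$; here $L_2=L_2(\mathbb{R})$ is the Hilbert space of real-valued square-integrable functions. Then $\mathbb{Z}\wr\mathbb{Z}$ is finitely generated and, for every finite symmetric generating set $S$ of $\mathbb{Z}\wr\mathbb{Z}$, $$\alpha^*(\mathbb{Z}\wr\mathbb{Z})=\tfrac23 .$$ -/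

import Mathlib

open MeasureTheory
open scoped ENNReal NNReal

/-- The underlying set of the wreath product `ℤ ≀ ℤ`: pairs `(f, x)` with `f : ℤ → ℤ` of finite
support and `x : ℤ`. -/
@[ext]
structure WreathZZ where
  /-- the finitely supported function `f : ℤ → ℤ` -/
  lamps : ℤ →₀ ℤ
  /-- the base point `x : ℤ` -/
  pos : ℤ

namespace WreathZZ

/-- The product `(f, x) (g, y) = (z ↦ f z + g (z - x), x + y)`; see `lamps_mul`. -/
noncomputable instance : Mul WreathZZ where
  mul a b := ⟨a.lamps + b.lamps.equivMapDomain (Equiv.addRight a.pos), a.pos + b.pos⟩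

instance : One WreathZZ where
  one := ⟨0, 0⟩

noncomputable instance : Inv WreathZZ where
  inv a := ⟨-a.lamps.equivMapDomain (Equiv.addRight (-a.pos)), -a.pos⟩

theorem lamps_mul (a b : WreathZZ) (z : ℤ) :
    (a * b).lamps z = a.lamps z + b.lamps (z - a.pos) := by
  change (a.lamps + b.lamps.equivMapDomain (Equiv.addRight a.pos)) z = _
  simp [Finsupp.equivMapDomain_apply, sub_eq_add_neg]

theorem pos_mul (a b : WreathZZ) : (a * b).pos = a.pos + b.pos := rfl

theorem lamps_one (z : ℤ) : (1 : WreathZZ).lamps z = 0 := rfl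

theorem pos_one : (1 : WreathZZ).pos = 0 := rfl

theorem lamps_inv (a : WreathZZ) (z : ℤ) : (a⁻¹).lamps z = -a.lamps (z + a.pos) := by
  change (-a.lamps.equivMapDomain (Equiv.addRight (-a.pos))) z = _
  simp [Finsupp.equivMapDomain_apply]

theorem pos_inv (a : WreathZZ) : (a⁻¹).pos = -a.pos := rfl

/-- The group `ℤ ≀ ℤ`. -/
noncomputable instance : Group WreathZZ where
  mul_assoc a b c := by
    ext z
    · simp only [lamps_mul, pos_mul, add_assoc, sub_sub]
    · simp only [pos_mul, add_assoc]
  one_mul a := by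
    ext z <;> simp [lamps_mul, pos_mul, lamps_one, pos_one]
  mul_one a := by
    ext z <;> simp [lamps_mul, pos_mul, lamps_one, pos_one]
  inv_mul_cancel a := by
    ext z <;> simp [lamps_mul, pos_mul, lamps_one, pos_one, lamps_inv, pos_inv]

end WreathZZ

/-- Word length of `g` with respect to `S`: the least length of a word in elements of `S` whose
product is `g`. (It is only used for symmetric generating sets `S`, so that such a word exists.) -/
noncomputable def wordLength {G : Type*} [Group G] (S : Set G) (g : G) : ℕ :=
  sInf {n : ℕ | ∃ l : List G, (∀ s ∈ l, s ∈ S) ∧ l.prod = g ∧ l.length = n}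

/-- The left-invariant word metric `d(x, y) = |x⁻¹ y|` induced by `S`. -/
noncomputable def wordDist {G : Type*} [Group G] (S : Set G) (x y : G) : ℕ :=
  wordLength S (x⁻¹ * y)

/-- The Hilbert space `L₂ = L₂(ℝ)` of real-valued square-integrable functions. -/
abbrev HilbertL2 : Type := Lp ℝ 2 (volume : Measure ℝ)

/-- There are a mapping `f : G → L₂`, `1`-Lipschitz for the word metric `d` of `S`, and a constant
`c > 0` such that `‖f x - f y‖ ≥ c d(x, y) ^ α` for all `x, y`. -/
def HasHilbertCompression {G : Type*} [Group G] (S : Set G) (α : ℝ) : Prop :=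
  ∃ f : G → HilbertL2,
    (∀ x y : G, ‖f x - f y‖ ≤ (wordDist S x y : ℝ)) ∧
    ∃ c : ℝ, 0 < c ∧ ∀ x y : G, c * (wordDist S x y : ℝ) ^ α ≤ ‖f x - f y‖

/-- The Hilbert compression exponent of a group `G` with finite symmetric generating set `S`: the
supremum, in `[0, ∞]`, of all `α ≥ 0` for which `HasHilbertCompression S α` holds. (The value
`α = 0`, where `0 ^ 0` occurs, has no influence on this supremum, whose least value is `0`.) -/
noncomputable def hilbertCompressionExponent {G : Type*} [Group G] (S : Set G) : ℝ≥0∞ :=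
  ⨆ (α : ℝ≥0) (_ : HasHilbertCompression S (α : ℝ)), (α : ℝ≥0∞)

/-! ### Word length in a general group -/

section WordLength

variable {G : Type*} [Group G] {S : Set G}

/-! Upper bound. The group is amenable, so averaging ‖F(hg) − F(h)‖² over h with a right invariant
mean turns an embedding F of exponent α into a function ψ with c²|g|^{2α} ≤ ψ(g) ≤ |g|²
(`RightInvariantMean.exists_averaged`), and independent copies Z, Z' of a random element satisfy E
ψ(Z⁻¹Z') ≤ 2 E ψ(Z). Start from a random lamp ±1 and repeat: append a uniform shift in [0, M) with M
≈ 2^{k/2}, then take the quotient of two independent copies. A round doubles E ψ up to a factor 1 +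
1/(k+1) and an error of order k·M² ≈ k·2^k, so E ψ ≲ k²2^k. The second moment of the lamps doubles
exactly, while the shift spreads it over about 2^{k/2} sites; the resulting fourth moment bound
forces the expected ℓ¹ norm of the lamps, hence the expected word length, to be ≳ 2^{3k/4}
(`exists_spread`, `le_expect_lampNorm_one`). By Jensen, 2^{3αk/2} ≲ k²2^k for all k, so α ≤ 2/3.

Lower bound. For g ≠ 1 the word length is ≲ N + R, with N the ℓ¹ norm of the lamps and R the radius
of the region visited. The embedding records the position, the lamps, and the tails of the
configuration on either side of the position, weighted by distance to the power β. For 0 < β < 1/2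
its increments are bounded, and the squared distance D of two images satisfies D ≳ R^{2β+1} and D ≳
N²/(2R+1) (`exists_embedding`). With 2β + 1 = 3α this gives D ≳ (N + R)^{2α} for every 1/3 < α < 2/3
(`rpow_add_le`). -/

theorem exists_word_of_closure_eq_top (hinv : ∀ s ∈ S, s⁻¹ ∈ S) (hS : Subgroup.closure S = ⊤)
    (g : G) : ∃ l : List G, (∀ s ∈ l, s ∈ S) ∧ l.prod = g := by
  have hg : g ∈ (Subgroup.closure S).toSubmonoid := by simp [hS]
  rw [Subgroup.closure_toSubmonoid] at hg
  obtain ⟨l, hl, rfl⟩ := Submonoid.exists_list_of_mem_closure hg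
  refine ⟨l, fun s hs => ?_, rfl⟩
  rcases hl s hs with h | h
  · exact h
  · simpa using hinv _ h

theorem exists_word_length_eq (hinv : ∀ s ∈ S, s⁻¹ ∈ S) (hS : Subgroup.closure S = ⊤)
    (g : G) : ∃ l : List G, (∀ s ∈ l, s ∈ S) ∧ l.prod = g ∧ l.length = wordLength S g := by
  obtain ⟨l, hl, hg⟩ := exists_word_of_closure_eq_top hinv hS g
  exact Nat.sInf_mem (s := {n : ℕ | ∃ l : List G, (∀ s ∈ l, s ∈ S) ∧ l.prod = g ∧ l.length = n})
    ⟨l.length, l, hl, hg, rfl⟩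

theorem wordLength_prod_le {l : List G} (hl : ∀ s ∈ l, s ∈ S) : wordLength S l.prod ≤ l.length :=
  Nat.sInf_le ⟨l, hl, rfl, rfl⟩

theorem wordLength_one : wordLength S (1 : G) = 0 :=
  Nat.le_zero.1 (wordLength_prod_le (S := S) (l := []) (by simp))

theorem wordLength_mul_le (hinv : ∀ s ∈ S, s⁻¹ ∈ S) (hS : Subgroup.closure S = ⊤) (g h : G) :
    wordLength S (g * h) ≤ wordLength S g + wordLength S h := by
  obtain ⟨l, hl, hg, hlg⟩ := exists_word_length_eq hinv hS g
  obtain ⟨l', hl', hh, hlh⟩ := exists_word_length_eq hinv hS h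
  rw [← hlg, ← hlh, ← List.length_append, ← hg, ← hh, ← List.prod_append]
  refine wordLength_prod_le fun s hs => ?_
  rcases List.mem_append.1 hs with h | h
  exacts [hl s h, hl' s h]

theorem wordLength_inv_le (hinv : ∀ s ∈ S, s⁻¹ ∈ S) (hS : Subgroup.closure S = ⊤) (g : G) :
    wordLength S g⁻¹ ≤ wordLength S g := by
  obtain ⟨l, hl, hg, hlg⟩ := exists_word_length_eq hinv hS g
  rw [← hlg, ← hg, List.prod_inv_reverse]
  refine (wordLength_prod_le fun s hs => ?_).trans (by simp)
  simp only [List.mem_reverse, List.mem_map] at hs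
  obtain ⟨a, ha, rfl⟩ := hs
  exact hinv _ (hl a ha)

theorem wordLength_pow_le (hinv : ∀ s ∈ S, s⁻¹ ∈ S) (hS : Subgroup.closure S = ⊤) (g : G)
    (n : ℕ) : wordLength S (g ^ n) ≤ n * wordLength S g := by
  induction n with
  | zero => simp [wordLength_one]
  | succ n ih =>
    rw [pow_succ, Nat.succ_mul]
    exact (wordLength_mul_le hinv hS _ _).trans (by gcongr)

theorem wordLength_zpow_le (hinv : ∀ s ∈ S, s⁻¹ ∈ S) (hS : Subgroup.closure S = ⊤) (g : G)
    (n : ℤ) : wordLength S (g ^ n) ≤ n.natAbs * wordLength S g := by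
  obtain ⟨m, rfl | rfl⟩ := n.eq_nat_or_neg
  · simpa using wordLength_pow_le hinv hS g m
  · simpa using (wordLength_inv_le hinv hS _).trans (wordLength_pow_le hinv hS g m)

/-- A function that grows by at most `C` along each edge of the Cayley graph grows at most
linearly in the word length. -/
theorem le_mul_wordLength (hinv : ∀ s ∈ S, s⁻¹ ∈ S) (hS : Subgroup.closure S = ⊤) {N : G → ℝ}
    {C : ℝ} (h1 : N 1 = 0) (hN : ∀ g, ∀ s ∈ S, N (g * s) ≤ N g + C) (g : G) :
    N g ≤ C * wordLength S g := by
  obtain ⟨l, hl, hg, hlg⟩ := exists_word_length_eq hinv hS g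
  rw [← hlg, ← hg]
  clear hlg hg
  induction l using List.reverseRecOn with
  | nil => simp [h1]
  | append_singleton l s ih =>
    have h2 := hN l.prod s (hl s (by simp))
    have h3 := ih fun s hs => hl s (by simp [hs])
    simp only [List.prod_append, List.prod_singleton, List.length_append, List.length_singleton]
    push_cast
    linarith

theorem wordDist_mul_left (h x y : G) : wordDist S (h * x) (h * y) = wordDist S x y := by
  simp [wordDist, mul_assoc]

theorem wordDist_self_mul (x g : G) : wordDist S x (x * g) = wordLength S g := by
  simp [wordDist]

end WordLength

/-! ### Lamp norms and word length in `ℤ ≀ ℤ` -/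

namespace WreathZZ

/-- The element that adds `c` to the lamp at the current position. -/
noncomputable def lamp (c : ℤ) : WreathZZ := ⟨Finsupp.single 0 c, 0⟩

/-- The element that moves the position by `n`. -/
noncomputable def shift (n : ℤ) : WreathZZ := ⟨0, n⟩

@[simp] theorem pos_lamp (c : ℤ) : (lamp c).pos = 0 := rfl

@[simp] theorem pos_shift (n : ℤ) : (shift n).pos = n := rfl

@[simp] theorem lamps_shift (n : ℤ) : (shift n).lamps = 0 := rfl

theorem lamps_lamp (c z : ℤ) : (lamp c).lamps z = if z = 0 then c else 0 := by
  simp [lamp, Finsupp.single_apply, eq_comm]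

theorem lamps_mul_shift (g : WreathZZ) (n : ℤ) : (g * shift n).lamps = g.lamps := by
  ext z; simp [lamps_mul]

theorem lamps_mul_lamp (g : WreathZZ) (c z : ℤ) :
    (g * lamp c).lamps z = g.lamps z + if z = g.pos then c else 0 := by
  simp [lamps_mul, lamps_lamp, sub_eq_zero]

theorem shift_add (m n : ℤ) : shift (m + n) = shift m * shift n := by
  ext z <;> simp [lamps_mul, pos_mul]

theorem lamp_add (m n : ℤ) : lamp (m + n) = lamp m * lamp n := by
  ext z
  · simp only [lamps_mul, lamps_lamp, pos_lamp, sub_zero]; split_ifs <;> simp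
  · simp [pos_mul]

theorem shift_zero : shift 0 = 1 := rfl

theorem lamp_zero : lamp 0 = 1 := by
  ext z <;> simp [lamps_lamp, lamps_one, pos_one]

theorem shift_zpow (n : ℤ) : shift 1 ^ n = shift n := by
  induction n with
  | zero => simp [shift_zero]
  | succ n ih => rw [zpow_add_one, ih, ← shift_add]
  | pred n ih =>
    rw [zpow_sub_one, ih, mul_inv_eq_iff_eq_mul, ← shift_add, sub_add_cancel]

theorem lamp_zpow (n : ℤ) : lamp 1 ^ n = lamp n := by
  induction n with
  | zero => simp [lamp_zero]
  | succ n ih => rw [zpow_add_one, ih, ← lamp_add]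
  | pred n ih =>
    rw [zpow_sub_one, ih, mul_inv_eq_iff_eq_mul, ← lamp_add, sub_add_cancel]

/-- The `p`-th power of the `ℓᵖ` norm of the lamp configuration. -/
noncomputable def lampNorm (p : ℕ) (f : ℤ →₀ ℤ) : ℝ := ∑' z, |(f z : ℝ)| ^ p

theorem summable_comp (f : ℤ →₀ ℤ) (φ : ℤ → ℝ) (hφ : φ 0 = 0) : Summable fun z => φ (f z) := by
  refine summable_of_hasFiniteSupport (f.hasFiniteSupport.subset fun z hz => ?_)
  contrapose! hz
  have : f z = 0 := by simpa using hz
  simp [this, hφ]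

theorem summable_lampNorm {p : ℕ} (hp : p ≠ 0) (f : ℤ →₀ ℤ) :
    Summable fun z => |(f z : ℝ)| ^ p :=
  summable_comp f (fun c => |(c : ℝ)| ^ p) (by simp [hp])

theorem lampNorm_nonneg (p : ℕ) (f : ℤ →₀ ℤ) : 0 ≤ lampNorm p f :=
  tsum_nonneg fun _ => by positivity

theorem lampNorm_one_add_le (f g : ℤ →₀ ℤ) :
    lampNorm 1 (f + g) ≤ lampNorm 1 f + lampNorm 1 g := by
  unfold lampNorm
  rw [← (summable_lampNorm one_ne_zero f).tsum_add (summable_lampNorm one_ne_zero g)]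
  refine (summable_lampNorm one_ne_zero (f + g)).tsum_le_tsum (fun z => ?_)
    ((summable_lampNorm one_ne_zero f).add (summable_lampNorm one_ne_zero g))
  simpa using abs_add_le (f z : ℝ) (g z)

theorem lampNorm_equivMapDomain (p : ℕ) (e : ℤ ≃ ℤ) (f : ℤ →₀ ℤ) :
    lampNorm p (f.equivMapDomain e) = lampNorm p f := by
  simp only [lampNorm, Finsupp.equivMapDomain_apply]
  exact e.symm.tsum_eq fun z => |(f z : ℝ)| ^ p

theorem lampNorm_mul_le (g h : WreathZZ) :
    lampNorm 1 (g * h).lamps ≤ lampNorm 1 g.lamps + lampNorm 1 h.lamps := by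
  change lampNorm 1 (g.lamps + h.lamps.equivMapDomain _) ≤ _
  exact (lampNorm_one_add_le _ _).trans (by rw [lampNorm_equivMapDomain])

theorem lampNorm_zero {p : ℕ} (hp : p ≠ 0) : lampNorm p 0 = 0 := by simp [lampNorm, hp]

theorem lampNorm_single {p : ℕ} (hp : p ≠ 0) (z c : ℤ) :
    lampNorm p (Finsupp.single z c) = |(c : ℝ)| ^ p := by
  unfold lampNorm
  rw [tsum_eq_single z fun w hw => by simp [hw.symm, hp]]
  simp

section Generators

variable {S : Set WreathZZ}

/-- The ℓ¹ norm is subadditive and translation invariant, and bounded on the finite set `S`. This is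
the only lower bound on word length that the bound α ≤ 2/3 uses. -/
theorem exists_lampNorm_le (hfin : S.Finite) (hinv : ∀ s ∈ S, s⁻¹ ∈ S)
    (hS : Subgroup.closure S = ⊤) :
    ∃ C : ℝ, 0 < C ∧ ∀ g : WreathZZ, lampNorm 1 g.lamps ≤ C * wordLength S g := by
  obtain ⟨C, hC⟩ := (hfin.image fun s => lampNorm 1 s.lamps).bddAbove
  refine ⟨max C 1, by positivity, le_mul_wordLength hinv hS ?_ fun g s hs => ?_⟩
  · exact lampNorm_zero one_ne_zero
  · refine (lampNorm_mul_le g s).trans ?_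
    have : lampNorm 1 s.lamps ≤ C := hC ⟨s, hs, rfl⟩
    linarith [le_max_left C 1]

/-- A configuration supported in `[0, n)` can be lit while walking from `0` to `n`. -/
theorem wordLength_le_of_support_nonneg (hinv : ∀ s ∈ S, s⁻¹ ∈ S)
    (hS : Subgroup.closure S = ⊤) {C : ℕ} (hC₁ : wordLength S (lamp 1) ≤ C)
    (hC₂ : wordLength S (shift 1) ≤ C) (n : ℕ) (f : ℤ →₀ ℤ)
    (hf : ∀ z, f z ≠ 0 → 0 ≤ z ∧ z < n) :
    (wordLength S ⟨f, n⟩ : ℝ) ≤ C * (lampNorm 1 f + n) := by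
  induction n generalizing f with
  | zero =>
    have h0 : f = 0 := by
      ext z
      by_contra h
      have := hf z h
      simp at this
      omega
    subst h0
    have : (⟨0, ((0 : ℕ) : ℤ)⟩ : WreathZZ) = 1 := rfl
    rw [this, wordLength_one, lampNorm_zero one_ne_zero]
    simp
  | succ n ih =>
    have hmul : (⟨f, ((n + 1 : ℕ) : ℤ)⟩ : WreathZZ) = ⟨f.erase n, n⟩ * lamp (f n) * shift 1 := by
      ext z
      · rw [lamps_mul_shift, lamps_mul_lamp]
        by_cases hz : z = n
        · simp [hz]
        · simp [hz, Finsupp.erase_ne hz]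
      · simp [pos_mul]
    have h1 := ih (f.erase n) fun z hz => by
      by_cases h : z = n
      · simp [h] at hz
      · rw [Finsupp.erase_ne h] at hz
        have := hf z hz
        push_cast at this
        omega
    have h2 : lampNorm 1 f = lampNorm 1 (f.erase n) + |(f n : ℝ)| := by
      unfold lampNorm
      rw [(summable_lampNorm one_ne_zero f).tsum_eq_add_tsum_ite (n : ℤ), pow_one, add_comm]
      congr 2
      ext z
      by_cases hz : z = n
      · simp [hz]
      · simp [hz, Finsupp.erase_ne hz]
    have h3 : (wordLength S (lamp (f n)) : ℝ) ≤ |(f n : ℝ)| * C := by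
      rw [← lamp_zpow, ← Int.cast_abs, Int.abs_eq_natAbs, Int.cast_natCast]
      exact_mod_cast (wordLength_zpow_le hinv hS _ _).trans (Nat.mul_le_mul_left _ hC₁)
    have h4 : (wordLength S ⟨f, ((n + 1 : ℕ) : ℤ)⟩ : ℝ) ≤ wordLength S ⟨f.erase n, n⟩ +
        wordLength S (lamp (f n)) + wordLength S (shift 1) := by
      rw [hmul]
      exact_mod_cast (wordLength_mul_le hinv hS _ _).trans
        (Nat.add_le_add_right (wordLength_mul_le hinv hS _ _) _)
    have h5 : (wordLength S (shift 1) : ℝ) ≤ C := by exact_mod_cast hC₂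
    rw [h2]
    push_cast at h4 ⊢
    linarith

theorem wordLength_shift_le (hinv : ∀ s ∈ S, s⁻¹ ∈ S) (hS : Subgroup.closure S = ⊤) {C : ℕ}
    (hC : wordLength S (shift 1) ≤ C) (n : ℤ) : wordLength S (shift n) ≤ n.natAbs * C := by
  rw [← shift_zpow]
  exact (wordLength_zpow_le hinv hS _ _).trans (Nat.mul_le_mul_left _ hC)

/-- Walk to −R, sweep across [−R, R] setting every lamp, and return from R + 1 to the final
position: the walking costs at most R + (2R + 1) + (2R + 1) = 5R + 2 shifts. -/
theorem exists_wordLength_le (hinv : ∀ s ∈ S, s⁻¹ ∈ S) (hS : Subgroup.closure S = ⊤) :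
    ∃ C : ℝ, 0 < C ∧ ∀ (g : WreathZZ) (R : ℕ), (∀ z, g.lamps z ≠ 0 → |z| ≤ R) → |g.pos| ≤ R →
      (wordLength S g : ℝ) ≤ C * (lampNorm 1 g.lamps + 5 * R + 2) := by
  set C := max (wordLength S (lamp 1)) (wordLength S (shift 1)) + 1 with hCdef
  have hC₁ : wordLength S (lamp 1) ≤ C := by omega
  have hC₂ : wordLength S (shift 1) ≤ C := by omega
  refine ⟨C, by positivity, fun g R hsupp hpos => ?_⟩
  set f : ℤ →₀ ℤ := g.lamps.equivMapDomain (Equiv.addRight (R : ℤ)) with hf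
  have hfz : ∀ z, f z = g.lamps (z - R) := fun z => by
    simp [hf, Finsupp.equivMapDomain_apply, sub_eq_add_neg]
  have hg : g = shift (-R) * ⟨f, ((2 * R + 1 : ℕ) : ℤ)⟩ * shift (g.pos - R - 1) := by
    ext z
    · simp [lamps_mul_shift, lamps_mul, hfz]
    · simp [pos_mul]; ring
  have h1 := wordLength_le_of_support_nonneg hinv hS hC₁ hC₂ (2 * R + 1) f fun z hz => by
    rw [hfz] at hz
    have := abs_le.1 (hsupp _ hz)
    push_cast
    omega
  have h2 : wordLength S (shift (-R)) ≤ R * C := by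
    simpa using wordLength_shift_le hinv hS hC₂ (-R)
  have h3 : wordLength S (shift (g.pos - R - 1)) ≤ (2 * R + 1) * C := by
    refine (wordLength_shift_le hinv hS hC₂ _).trans (Nat.mul_le_mul_right _ ?_)
    have := abs_le.1 hpos
    omega
  have h4 : wordLength S g ≤ wordLength S (shift (-R)) +
      wordLength S ⟨f, ((2 * R + 1 : ℕ) : ℤ)⟩ + wordLength S (shift (g.pos - R - 1)) := by
    conv_lhs => rw [hg]
    exact (wordLength_mul_le hinv hS _ _).trans
      (Nat.add_le_add_right (wordLength_mul_le hinv hS _ _) _)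
  have h5 : lampNorm 1 f = lampNorm 1 g.lamps := lampNorm_equivMapDomain _ _ _
  rw [h5] at h1
  have h2' : (wordLength S (shift (-R)) : ℝ) ≤ R * C := by exact_mod_cast h2
  have h3' : (wordLength S (shift (g.pos - R - 1)) : ℝ) ≤ (2 * R + 1) * C := by exact_mod_cast h3
  have h4' : (wordLength S g : ℝ) ≤ wordLength S (shift (-R)) +
      wordLength S ⟨f, ((2 * R + 1 : ℕ) : ℤ)⟩ + wordLength S (shift (g.pos - R - 1)) := by
    exact_mod_cast h4
  push_cast at h1 h4'
  linarith

end Generators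

theorem closure_lamp_shift : Subgroup.closure {lamp 1, shift 1} = (⊤ : Subgroup WreathZZ) := by
  set H := Subgroup.closure {lamp 1, shift 1} with hH
  have hlamp : ∀ c, lamp c ∈ H := fun c => by
    rw [← lamp_zpow]
    exact H.zpow_mem (Subgroup.subset_closure (by simp)) _
  have hshift : ∀ n, shift n ∈ H := fun n => by
    rw [← shift_zpow]
    exact H.zpow_mem (Subgroup.subset_closure (by simp)) _
  have hbase : ∀ f : ℤ →₀ ℤ, (⟨f, 0⟩ : WreathZZ) ∈ H := fun f => by
    induction f using Finsupp.induction_linear with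
    | zero => exact H.one_mem
    | add f g hf hg =>
      have : (⟨f + g, 0⟩ : WreathZZ) = ⟨f, 0⟩ * ⟨g, 0⟩ := by
        ext z <;> simp [lamps_mul, pos_mul]
      rw [this]
      exact H.mul_mem hf hg
    | single z c =>
      have : (⟨Finsupp.single z c, 0⟩ : WreathZZ) = shift z * lamp c * shift (-z) := by
        ext w
        · simp [lamps_mul_shift, lamps_mul_lamp, Finsupp.single_apply, eq_comm]
        · simp [pos_mul]
      rw [this]
      exact H.mul_mem (H.mul_mem (hshift _) (hlamp _)) (hshift _)
  refine (Subgroup.eq_top_iff' _).2 fun g => ?_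
  have : g = ⟨g.lamps, 0⟩ * shift g.pos := by
    ext w
    · rw [lamps_mul_shift]
    · simp [pos_mul]
  rw [this]
  exact H.mul_mem (hbase _) (hshift _)

theorem group_fg : Group.FG WreathZZ :=
  Group.fg_iff.2 ⟨_, closure_lamp_shift, by simp⟩

end WreathZZ

/-! ### Amenability: Følner sets and invariant means -/

open Filter Topology in
/-- The finite sets `A n` are asymptotically invariant under right translation by `s`: the proportion
of `A n` that the translation pushes outside of `A n` tends to zero. -/
def IsRightFolner {G : Type*} [Group G] [DecidableEq G] (A : ℕ → Finset G) (s : G) : Prop :=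
  Tendsto (fun n => (((A n).filter fun g => g * s ∉ A n).card : ℝ) / (A n).card) atTop (𝓝 0)

/-- A right invariant mean on the bounded real functions on a group. -/
structure RightInvariantMean (G : Type*) [Group G] where
  /-- The mean value, meaningful on bounded functions. -/
  mean : (G → ℝ) → ℝ
  add' : ∀ {φ χ : G → ℝ}, (∃ K, ∀ g, |φ g| ≤ K) → (∃ K, ∀ g, |χ g| ≤ K) →
    mean (fun g => φ g + χ g) = mean φ + mean χ
  smul' : ∀ (c : ℝ) {φ : G → ℝ}, (∃ K, ∀ g, |φ g| ≤ K) → mean (fun g => c * φ g) = c * mean φ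
  const' : ∀ c : ℝ, mean (fun _ => c) = c
  mono' : ∀ {φ χ : G → ℝ}, (∃ K, ∀ g, |φ g| ≤ K) → (∃ K, ∀ g, |χ g| ≤ K) →
    (∀ g, φ g ≤ χ g) → mean φ ≤ mean χ
  inv' : ∀ (s : G) {φ : G → ℝ}, (∃ K, ∀ g, |φ g| ≤ K) → mean (fun g => φ (g * s)) = mean φ

section Folner

variable {G : Type*} [Group G]

/-- The terms common to `A` and its translate cancel. The two remaining differences have equal
cardinality because translation is injective. -/
theorem abs_sum_translate_sub_sum_le [DecidableEq G] (A : Finset G) (s : G) {φ : G → ℝ} {K : ℝ}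
    (hφ : ∀ g, |φ g| ≤ K) :
    |∑ g ∈ A, φ (g * s) - ∑ g ∈ A, φ g| ≤ 2 * K * (A.filter fun g => g * s ∉ A).card := by
  set e : G ↪ G := mulRightEmbedding s
  have h1 : ∑ g ∈ A, φ (g * s) = ∑ g ∈ A.map e, φ g := by simp [e]
  have h2 : ((A.map e) \ A).card = (A.filter fun g => g * s ∉ A).card := by
    have : (A.map e) \ A = (A.filter fun g => g * s ∉ A).map e := by
      ext g
      simp only [Finset.mem_sdiff, Finset.mem_map, Finset.mem_filter]
      constructor
      · rintro ⟨⟨a, ha, rfl⟩, h⟩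
        exact ⟨a, ⟨ha, h⟩, rfl⟩
      · rintro ⟨a, ⟨ha, h⟩, rfl⟩
        exact ⟨⟨a, ha, rfl⟩, h⟩
    rw [this, Finset.card_map]
  have h3 : (A \ A.map e).card = ((A.map e) \ A).card :=
    Finset.card_sdiff_comm (by simp)
  have h4 : ∀ B : Finset G, |∑ g ∈ B, φ g| ≤ K * B.card := fun B =>
    (Finset.abs_sum_le_sum_abs _ _).trans
      ((Finset.sum_le_card_nsmul _ _ K fun g _ => hφ g).trans (by simp [mul_comm]))
  rw [h1, ← Finset.sum_sdiff_sub_sum_sdiff]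
  have h5 := h4 ((A.map e) \ A)
  have h6 := h4 (A \ A.map e)
  rw [h3] at h6
  rw [h2] at h5 h6
  refine (abs_sub _ _).trans ?_
  linarith

open Filter Topology in
-- The mean is the limit of the averages over `A n` along a free ultrafilter. Følner sets give
-- invariance under the generators, and the elements that preserve the mean form a subgroup.
theorem exists_rightInvariantMean [DecidableEq G] (A : ℕ → Finset G)
    (hne : ∀ n, (A n).Nonempty) (S : Set G) (hS : Subgroup.closure S = ⊤)
    (hA : ∀ s ∈ S, IsRightFolner A s) : Nonempty (RightInvariantMean G) := by
  classical
  set avg : (G → ℝ) → ℕ → ℝ := fun φ n => (∑ g ∈ A n, φ g) / (A n).card with havg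
  set U : Ultrafilter ℕ := hyperfilter ℕ
  have hcard : ∀ n, (0 : ℝ) < (A n).card := fun n => by exact_mod_cast (hne n).card_pos
  have hbd : ∀ {φ : G → ℝ} {K : ℝ}, (∀ g, |φ g| ≤ K) → ∀ n, avg φ n ∈ Set.Icc (-K) K := by
    intro φ K hφ n
    rw [Set.mem_Icc, ← abs_le, havg, abs_div, abs_of_pos (hcard n), div_le_iff₀ (hcard n)]
    exact (Finset.abs_sum_le_sum_abs _ _).trans
      ((Finset.sum_le_card_nsmul _ _ K fun g _ => hφ g).trans (by simp [mul_comm]))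
  have hlim : ∀ {φ : G → ℝ}, (∃ K, ∀ g, |φ g| ≤ K) →
      Tendsto (avg φ) U (𝓝 (limUnder (U : Filter ℕ) (avg φ))) := by
    rintro φ ⟨K, hφ⟩
    obtain ⟨x, -, hx⟩ := (isCompact_Icc (a := -K) (b := K)).ultrafilter_le_nhds' (U.map (avg φ))
      (Ultrafilter.mem_map.2 (Filter.univ_mem' (hbd hφ)))
    exact tendsto_nhds_limUnder ⟨x, hx⟩
  have hinv : ∀ s ∈ S, ∀ φ : G → ℝ, (∃ K, ∀ g, |φ g| ≤ K) →
      limUnder (U : Filter ℕ) (avg fun g => φ (g * s)) = limUnder (U : Filter ℕ) (avg φ) := by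
    rintro s hs φ ⟨K, hφ⟩
    have h1 := hlim ⟨K, hφ⟩
    have h2 := hlim (φ := fun g => φ (g * s)) ⟨K, fun g => hφ _⟩
    have h3 : Tendsto (fun n => avg (fun g => φ (g * s)) n - avg φ n) U (𝓝 0) := by
      have h4 := ((hA s hs).const_mul (2 * K)).mono_left (Nat.hyperfilter_le_atTop)
      rw [mul_zero] at h4
      refine squeeze_zero_norm (fun n => ?_) h4
      rw [Real.norm_eq_abs, havg, ← sub_div, abs_div, abs_of_pos (hcard n), ← mul_div_assoc]
      gcongr
      exact abs_sum_translate_sub_sum_le _ _ hφ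
    exact sub_eq_zero.1 (tendsto_nhds_unique (h2.sub h1) h3)
  refine ⟨⟨fun φ => limUnder (U : Filter ℕ) (avg φ), ?_, ?_, ?_, ?_, ?_⟩⟩
  · intro φ χ hφ hχ
    refine Tendsto.limUnder_eq (((hlim hφ).add (hlim hχ)).congr fun n => ?_)
    simp only [havg]
    rw [Finset.sum_add_distrib, add_div]
  · intro c φ hφ
    refine Tendsto.limUnder_eq (((hlim hφ).const_mul c).congr fun n => ?_)
    simp only [havg]
    rw [← Finset.mul_sum, mul_div_assoc]
  · intro c
    refine Tendsto.limUnder_eq (tendsto_const_nhds.congr fun n => ?_)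
    simp only [havg, Finset.sum_const, nsmul_eq_mul]
    rw [mul_comm, mul_div_assoc, div_self (hcard n).ne', mul_one]
  · intro φ χ hφ hχ h
    refine le_of_tendsto_of_tendsto' (hlim hφ) (hlim hχ) fun n => ?_
    simp only [havg]
    gcongr
    exact h _
  · intro s
    have hs : s ∈ Subgroup.closure S := by simp [hS]
    induction hs using Subgroup.closure_induction with
    | mem x hx => exact fun {φ} hφ => hinv x hx φ hφ
    | one => simp
    | mul x y _ _ hx hy =>
      intro φ hφ
      have h1 := hy hφ
      have h2 := hx (φ := fun g => φ (g * y)) (hφ.imp fun K h g => h _)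
      rw [← h1, ← h2]
      simp [mul_assoc]
    | inv x _ hx =>
      intro φ hφ
      have h1 := hx (φ := fun g => φ (g * x⁻¹)) (hφ.imp fun K h g => h _)
      rw [← h1]
      simp

/-- If the elements of `A` that leave `A` under translation by `s` have `N` disjoint translates
inside `A`, there are at most `A.card / N` of them. -/
theorem card_filter_mul_le [DecidableEq G] (A : Finset G) (s : G) (N : ℕ) (P : ℕ → G → G)
    (hP : ∀ g ∈ A, g * s ∉ A → ∀ i < N, P i g ∈ A)
    (hinj : ∀ g ∈ A, g * s ∉ A → ∀ g' ∈ A, g' * s ∉ A → ∀ i < N, ∀ j < N, P i g = P j g' →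
      i = j ∧ g = g') :
    N * (A.filter fun g => g * s ∉ A).card ≤ A.card := by
  rw [← Finset.card_range N, ← Finset.card_product]
  refine Finset.card_le_card_of_injOn (fun p => P p.1 p.2) ?_ ?_
  · rintro ⟨i, g⟩ h
    simp only [Finset.coe_product, Set.mem_prod, Finset.mem_coe, Finset.mem_range,
      Finset.mem_filter] at h
    exact hP g h.2.1 h.2.2 i h.1
  · rintro ⟨i, g⟩ h ⟨j, g'⟩ h' heq
    simp only [Finset.coe_product, Set.mem_prod, Finset.mem_coe, Finset.mem_range,
      Finset.mem_filter] at h h'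
    obtain ⟨h1, h2⟩ := hinj g h.2.1 h.2.2 g' h'.2.1 h'.2.2 i h.1 j h'.1 heq
    rw [h1, h2]

theorem isRightFolner_of_card_le [DecidableEq G] {A : ℕ → Finset G} {s : G}
    (hne : ∀ n, (A n).Nonempty)
    (h : ∀ n, (n + 1) * ((A n).filter fun g => g * s ∉ A n).card ≤ (A n).card) :
    IsRightFolner A s := by
  refine squeeze_zero (fun n => by positivity) (fun n => ?_) tendsto_one_div_add_atTop_nhds_zero_nat
  have h0 : (0 : ℝ) < (A n).card := by exact_mod_cast (hne n).card_pos
  rw [div_le_div_iff₀ h0 (by positivity), one_mul, mul_comm]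
  exact_mod_cast h n

end Folner

namespace WreathZZ

/-- Position and lamps in `[0, N)`, lamp values in `[0, N)`. -/
noncomputable def folnerBox (N : ℕ) : Finset WreathZZ :=
  (((Finset.Ico (0 : ℤ) N).finsupp fun _ => Finset.Ico (0 : ℤ) N) ×ˢ Finset.Ico (0 : ℤ) N).map
    ⟨fun p => ⟨p.1, p.2⟩, fun p q h => by
      rw [WreathZZ.mk.injEq] at h
      exact Prod.ext h.1 h.2⟩

theorem mem_folnerBox {N : ℕ} {g : WreathZZ} :
    g ∈ folnerBox N ↔ (0 ≤ g.pos ∧ g.pos < N) ∧ (∀ z, g.lamps z ≠ 0 → 0 ≤ z ∧ z < N) ∧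
      ∀ z : ℤ, 0 ≤ z → z < N → 0 ≤ g.lamps z ∧ g.lamps z < N := by
  have : g ∈ folnerBox N ↔ (g.lamps, g.pos) ∈
      ((Finset.Ico (0 : ℤ) N).finsupp fun _ => Finset.Ico (0 : ℤ) N) ×ˢ Finset.Ico (0 : ℤ) N := by
    simp only [folnerBox, Finset.mem_map]
    constructor
    · rintro ⟨p, hp, rfl⟩
      exact hp
    · exact fun h => ⟨_, h, rfl⟩
  rw [this, Finset.mem_product, Finset.mem_finsupp_iff]
  simp only [Finset.mem_Ico, Finset.subset_iff, Finsupp.mem_support_iff]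
  constructor
  · rintro ⟨⟨h1, h2⟩, h3⟩
    exact ⟨h3, fun z => @h1 z, fun z h h' => h2 z ⟨h, h'⟩⟩
  · rintro ⟨h3, h1, h2⟩
    exact ⟨⟨fun z => h1 z, fun z h => h2 z h.1 h.2⟩, h3⟩

theorem folnerBox_nonempty (n : ℕ) : (folnerBox (n + 1)).Nonempty := by
  refine ⟨1, mem_folnerBox.2 ⟨⟨le_rfl, ?_⟩, fun z h => absurd (lamps_one z) h, fun z _ _ => ?_⟩⟩
  · rw [pos_one]; positivity
  · rw [lamps_one]; exact ⟨le_rfl, by positivity⟩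

theorem mul_lamp_mem_folnerBox {N : ℕ} {g : WreathZZ} (hg : g ∈ folnerBox N) (c : ℤ) :
    g * lamp c ∈ folnerBox N ↔ 0 ≤ g.lamps g.pos + c ∧ g.lamps g.pos + c < N := by
  rw [mem_folnerBox] at hg ⊢
  obtain ⟨h1, h2, h3⟩ := hg
  simp only [pos_mul, pos_lamp, add_zero, lamps_mul_lamp]
  constructor
  · rintro ⟨-, -, h⟩
    simpa using h g.pos h1.1 h1.2
  · refine fun h => ⟨h1, fun z hz => ?_, fun z hz hz' => ?_⟩
    · by_cases hzp : z = g.pos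
      · rw [hzp]; exact h1
      · exact h2 z (by simpa [hzp] using hz)
    · by_cases hzp : z = g.pos
      · simpa [hzp] using h
      · simpa [hzp] using h3 z hz hz'

theorem mul_shift_mem_folnerBox {N : ℕ} {g : WreathZZ} (hg : g ∈ folnerBox N) (c : ℤ) :
    g * shift c ∈ folnerBox N ↔ 0 ≤ g.pos + c ∧ g.pos + c < N := by
  rw [mem_folnerBox] at hg ⊢
  obtain ⟨h1, h2, h3⟩ := hg
  simp only [pos_mul, pos_shift, lamps_mul_shift]
  exact ⟨fun h => h.1, fun h => ⟨h, h2, h3⟩⟩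

/-- An element leaves the box under `lamp 1` only when its current lamp has the top value n, and
under `shift 1` only when its position is n. Stepping backwards from there gives n + 1 translates
that stay in the box, and the starting point is recovered from any of them. -/
theorem nonempty_rightInvariantMean : Nonempty (RightInvariantMean WreathZZ) := by
  classical
  refine exists_rightInvariantMean (fun n => folnerBox (n + 1)) folnerBox_nonempty _
    closure_lamp_shift ?_
  rintro s (rfl | rfl) <;> refine isRightFolner_of_card_le folnerBox_nonempty fun n => ?_
  · have key : ∀ g ∈ folnerBox (n + 1), g * lamp 1 ∉ folnerBox (n + 1) →
        g.lamps g.pos = n := fun g hg h => by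
      rw [mul_lamp_mem_folnerBox hg] at h
      obtain ⟨h1, -, h3⟩ := mem_folnerBox.1 hg
      have := h3 g.pos h1.1 h1.2
      push_cast at *
      omega
    refine card_filter_mul_le _ _ (n + 1) (fun i g => g * lamp (-i)) ?_ ?_
    · intro g hg h i hi
      rw [mul_lamp_mem_folnerBox hg, key g hg h]
      push_cast
      omega
    · intro g hg h g' hg' h' i hi j hj heq
      have h1 : g.pos = g'.pos := by simpa [pos_mul] using congrArg WreathZZ.pos heq
      have h2 := congrArg (fun g : WreathZZ => g.lamps g.pos) heq
      simp only [pos_mul, pos_lamp, add_zero, lamps_mul_lamp, if_true, key g hg h,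
        key g' hg' h'] at h2
      have h3 : i = j := by omega
      subst h3
      exact ⟨rfl, mul_right_cancel heq⟩
  · have key : ∀ g ∈ folnerBox (n + 1), g * shift 1 ∉ folnerBox (n + 1) →
        g.pos = n := fun g hg h => by
      rw [mul_shift_mem_folnerBox hg] at h
      obtain ⟨h1, -, -⟩ := mem_folnerBox.1 hg
      push_cast at *
      omega
    refine card_filter_mul_le _ _ (n + 1) (fun i g => g * shift (-i)) ?_ ?_
    · intro g hg h i hi
      rw [mul_shift_mem_folnerBox hg, key g hg h]
      push_cast
      omega
    · intro g hg h g' hg' h' i hi j hj heq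
      have h2 := congrArg WreathZZ.pos heq
      simp only [pos_mul, pos_shift, key g hg h, key g' hg' h'] at h2
      have h3 : i = j := by omega
      subst h3
      exact ⟨rfl, mul_right_cancel heq⟩

end WreathZZ

/-! ### Averaging an embedding over the mean -/

namespace RightInvariantMean

variable {G : Type*} [Group G] (m : RightInvariantMean G)

theorem mean_sum {ι : Type*} (T : Finset ι) {φ : ι → G → ℝ}
    (hφ : ∀ i ∈ T, ∃ K, ∀ g, |φ i g| ≤ K) :
    (∃ K, ∀ g, |∑ i ∈ T, φ i g| ≤ K) ∧
      m.mean (fun g => ∑ i ∈ T, φ i g) = ∑ i ∈ T, m.mean (φ i) := by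
  classical
  induction T using Finset.induction_on with
  | empty => exact ⟨⟨0, by simp⟩, by simpa using m.const' 0⟩
  | insert i T hi ih =>
    obtain ⟨⟨K, hK⟩, h⟩ := ih fun j hj => hφ j (Finset.mem_insert_of_mem hj)
    obtain ⟨L, hL⟩ := hφ i (Finset.mem_insert_self _ _)
    simp only [Finset.sum_insert hi]
    refine ⟨⟨L + K, fun g => (abs_add_le _ _).trans (add_le_add (hL g) (hK g))⟩, ?_⟩
    rw [m.add' ⟨L, hL⟩ ⟨K, hK⟩, h]

end RightInvariantMean

/-- The difference of the two sides is 2‖∑ (u i − v)‖². In probabilistic terms, two independent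
copies have mean squared distance at most twice the mean squared distance to a fixed point. -/
theorem sum_sum_norm_sub_sq_le {Ω E : Type*} [Fintype Ω] [NormedAddCommGroup E]
    [InnerProductSpace ℝ E] (u : Ω → E) (v : E) :
    ∑ i, ∑ j, ‖u j - u i‖ ^ 2 ≤ 2 * Fintype.card Ω * ∑ i, ‖u i - v‖ ^ 2 := by
  have h : ∀ i j, ‖u j - u i‖ ^ 2 =
      ‖u j - v‖ ^ 2 - 2 * inner ℝ (u j - v) (u i - v) + ‖u i - v‖ ^ 2 := fun i j => by
    rw [← norm_sub_sq_real, sub_sub_sub_cancel_right]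
  have h2 : ∑ i, ∑ j, inner ℝ (u j - v) (u i - v) = ‖∑ i, (u i - v)‖ ^ 2 := by
    rw [← real_inner_self_eq_norm_sq, inner_sum]
    exact Finset.sum_congr rfl fun i _ => (sum_inner _ _ _).symm
  simp only [h, Finset.sum_add_distrib, Finset.sum_sub_distrib, ← Finset.mul_sum, h2]
  simp only [Finset.sum_const, Finset.card_univ, nsmul_eq_mul, ← Finset.mul_sum]
  nlinarith [sq_nonneg ‖∑ i, (u i - v)‖]

/-- Averaging an embedding over an invariant mean gives a conditionally negative definite function
with the same growth. -/
theorem RightInvariantMean.exists_averaged {G E : Type*} [Group G] (m : RightInvariantMean G)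
    [NormedAddCommGroup E] [InnerProductSpace ℝ E] {S : Set G} (F : G → E)
    (hF : ∀ x y : G, ‖F x - F y‖ ≤ wordDist S x y) {c α : ℝ} (hc : 0 ≤ c)
    (hF' : ∀ x y : G, c * (wordDist S x y : ℝ) ^ α ≤ ‖F x - F y‖) :
    ∃ ψ : G → ℝ, (∀ g, c ^ 2 * ((wordLength S g : ℝ) ^ α) ^ 2 ≤ ψ g) ∧
      (∀ g, ψ g ≤ (wordLength S g : ℝ) ^ 2) ∧
      (∀ a b, ∀ t : ℝ, 0 < t →
        ψ (a * b) ≤ (1 + t) * ψ a + (1 + t⁻¹) * (wordLength S b : ℝ) ^ 2) ∧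
      ∀ (Ω : Type) [Fintype Ω] (Z : Ω → G),
        ∑ i, ∑ j, ψ ((Z i)⁻¹ * Z j) ≤ 2 * Fintype.card Ω * ∑ i, ψ (Z i) := by
  have hF1 : ∀ h g, ‖F (h * g) - F h‖ ≤ wordLength S g := fun h g => by
    rw [norm_sub_rev, ← wordDist_self_mul h g]
    exact hF _ _
  have hbd : ∀ x y, ∀ h, |‖F (h * x) - F (h * y)‖ ^ 2| ≤ (wordDist S x y : ℝ) ^ 2 :=
    fun x y h => by
      rw [abs_of_nonneg (by positivity), ← wordDist_mul_left h]
      gcongr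
      exact hF _ _
  have hbd1 : ∀ g, ∀ h, |‖F (h * g) - F h‖ ^ 2| ≤ (wordLength S g : ℝ) ^ 2 := fun g h => by
    rw [abs_of_nonneg (by positivity)]
    gcongr
    exact hF1 _ _
  have hcb : ∀ c : ℝ, ∃ K : ℝ, ∀ _ : G, |c| ≤ K := fun c => ⟨|c|, fun _ => le_rfl⟩
  refine ⟨fun g => m.mean fun h => ‖F (h * g) - F h‖ ^ 2, fun g => ?_, fun g => ?_,
    fun a b t ht => ?_, fun Ω _ Z => ?_⟩
  · rw [← m.const' (c ^ 2 * _)]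
    refine m.mono' (hcb _) ⟨_, hbd1 g⟩ fun h => ?_
    have := hF' h (h * g)
    rw [wordDist_self_mul, norm_sub_rev] at this
    rw [← mul_pow]
    gcongr
  · rw [← m.const' ((wordLength S g : ℝ) ^ 2)]
    exact m.mono' ⟨_, hbd1 g⟩ (hcb _) fun h => (abs_le.1 (hbd1 g h)).2
  · have hb : ∃ K : ℝ, ∀ h, |(1 + t) * ‖F (h * a) - F h‖ ^ 2| ≤ K :=
      ⟨(1 + t) * (wordLength S a : ℝ) ^ 2, fun h => by
        rw [abs_mul, abs_of_pos (by positivity : 0 < 1 + t)]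
        gcongr
        exact hbd1 a h⟩
    rw [← m.smul' _ ⟨_, hbd1 a⟩, ← m.const' ((1 + t⁻¹) * (wordLength S b : ℝ) ^ 2),
      ← m.add' hb (hcb _)]
    refine m.mono' ⟨_, hbd1 _⟩ ?_ fun h => ?_
    · obtain ⟨K, hK⟩ := hb
      exact ⟨K + |(1 + t⁻¹) * (wordLength S b : ℝ) ^ 2|, fun g =>
        (abs_add_le _ _).trans (add_le_add (hK g) le_rfl)⟩
    · have h1 := hF1 (h * a) b
      have h2 : ‖F (h * (a * b)) - F h‖ ≤ ‖F (h * a) - F h‖ + wordLength S b := by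
        have := norm_sub_le_norm_sub_add_norm_sub (F (h * (a * b))) (F (h * a)) (F h)
        rw [← mul_assoc] at this ⊢
        linarith
      refine (pow_le_pow_left₀ (norm_nonneg _) h2 2).trans ?_
      set p := ‖F (h * a) - F h‖
      set q : ℝ := (wordLength S b : ℝ)
      -- Weighting the cross term by t keeps the coefficient of ψ(a) close to 1, so that it can be
      -- iterated.
      have h3 : 2 * p * q ≤ t * p ^ 2 + t⁻¹ * q ^ 2 := by
        have : t * p ^ 2 + t⁻¹ * q ^ 2 - 2 * p * q = t⁻¹ * (t * p - q) ^ 2 := by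
          field_simp; ring
        have : 0 ≤ t⁻¹ * (t * p - q) ^ 2 := by positivity
        linarith
      linarith [add_sq p q]
  · have h1 : ∀ i j, m.mean (fun h => ‖F (h * ((Z i)⁻¹ * Z j)) - F h‖ ^ 2) =
        m.mean fun h => ‖F (h * Z j) - F (h * Z i)‖ ^ 2 := fun i j => by
      -- Right invariance enters here: replacing h by h · Z i turns the quotient into a difference
      -- of two values of F.
      rw [← m.inv' (Z i) ⟨_, hbd1 _⟩]
      simp [mul_assoc]
    have hb2 : ∀ i, (∃ K, ∀ h, |∑ j, ‖F (h * Z j) - F (h * Z i)‖ ^ 2| ≤ K) ∧ _ := fun i =>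
      m.mean_sum Finset.univ (φ := fun j h => ‖F (h * Z j) - F (h * Z i)‖ ^ 2)
        fun j _ => ⟨_, hbd _ _⟩
    have hb3 := m.mean_sum Finset.univ
      (φ := fun i h => ∑ j, ‖F (h * Z j) - F (h * Z i)‖ ^ 2) fun i _ => (hb2 i).1
    have hb4 := m.mean_sum Finset.univ (φ := fun i h => ‖F (h * Z i) - F h‖ ^ 2)
        fun i _ => ⟨_, hbd1 _⟩
    simp only [h1, ← (hb2 _).2]
    rw [← hb3.2, ← hb4.2, ← m.smul' _ hb4.1]
    refine m.mono' hb3.1 ?_ fun h => sum_sum_norm_sub_sq_le _ _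
    obtain ⟨K, hK⟩ := hb4.1
    exact ⟨|2 * (Fintype.card Ω : ℝ)| * K, fun h => by rw [abs_mul]; gcongr; exact hK h⟩

/-! ### Moments of differences of symmetric variables -/

section SymmetricVariables

variable {Ω : Type*} [Fintype Ω] {X : Ω → ℝ} {σ : Ω ≃ Ω}

theorem sum_pow_eq_zero_of_odd (hX : ∀ i, X (σ i) = -X i) {p : ℕ} (hp : Odd p) :
    ∑ i, X i ^ p = 0 := by
  have h : ∑ i, X i ^ p = ∑ i, -X i ^ p := by
    rw [← Equiv.sum_comp σ]
    simp [hX, hp.neg_pow]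
  rw [Finset.sum_neg_distrib] at h
  linarith

theorem sum_sum_sub_sq_eq (hX : ∀ i, X (σ i) = -X i) :
    ∑ i, ∑ j, (X j - X i) ^ 2 = 2 * Fintype.card Ω * ∑ i, X i ^ 2 := by
  have h1 := sum_pow_eq_zero_of_odd hX odd_one
  have h : ∀ i j, (X j - X i) ^ 2 = X j ^ 2 - 2 * X i ^ 1 * X j ^ 1 + X i ^ 2 := fun i j => by ring
  simp only [h, Finset.sum_add_distrib, Finset.sum_sub_distrib, ← Finset.mul_sum, h1]
  simp only [Finset.sum_const, Finset.card_univ, nsmul_eq_mul, ← Finset.mul_sum]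
  simp
  ring

/-- Odd moments vanish by symmetry, so only the pure fourth powers and the square-times-square term,
with binomial coefficient 6, survive. -/
theorem sum_sum_sub_pow_four_eq (hX : ∀ i, X (σ i) = -X i) :
    ∑ i, ∑ j, (X j - X i) ^ 4 =
      2 * Fintype.card Ω * ∑ i, X i ^ 4 + 6 * (∑ i, X i ^ 2) ^ 2 := by
  have h1 := sum_pow_eq_zero_of_odd hX odd_one
  have h3 := sum_pow_eq_zero_of_odd hX (p := 3) (by decide)
  have h : ∀ i j, (X j - X i) ^ 4 = X j ^ 4 - 4 * X i ^ 1 * X j ^ 3 + 6 * X i ^ 2 * X j ^ 2 -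
    4 * X i ^ 3 * X j ^ 1 + X i ^ 4 := fun i j => by ring
  simp only [h, Finset.sum_add_distrib, Finset.sum_sub_distrib, ← Finset.mul_sum, h1, h3,
    ← Finset.sum_mul]
  simp only [Finset.sum_const, Finset.card_univ, nsmul_eq_mul, ← Finset.mul_sum]
  simp
  ring

end SymmetricVariables

/-! ### Random elements and the upper bound 2/3 -/

namespace WreathZZ

theorem lamps_inv_mul (a b : WreathZZ) :
    (a⁻¹ * b).lamps = (b.lamps - a.lamps).equivMapDomain (Equiv.addRight (-a.pos)) := by
  ext z
  simp [lamps_mul, lamps_inv, pos_inv, Finsupp.equivMapDomain_apply]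
  ring

/-- Sitewise, y² ≤ t·y if y ≤ t and y² ≤ y⁴/t² otherwise. A second moment together with a fourth
moment bound thus yields a lower bound for the ℓ¹ norm. -/
theorem lampNorm_two_le (f : ℤ →₀ ℤ) {t : ℝ} (ht : 0 < t) :
    lampNorm 2 f ≤ t * lampNorm 1 f + lampNorm 4 f / t ^ 2 := by
  unfold lampNorm
  have h1 := (summable_lampNorm one_ne_zero f).mul_left t
  have h4 := (summable_lampNorm four_ne_zero f).div_const (t ^ 2)
  rw [← tsum_mul_left, ← tsum_div_const, ← h1.tsum_add h4]
  refine (summable_lampNorm two_ne_zero f).tsum_le_tsum (fun z => ?_) (h1.add h4)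
  set y := |(f z : ℝ)|
  have hy : 0 ≤ y := abs_nonneg _
  rcases le_total y t with h | h
  · have : y ^ 2 ≤ t * y ^ 1 := by nlinarith
    have : 0 ≤ y ^ 4 / t ^ 2 := by positivity
    linarith
  · have : y ^ 2 ≤ y ^ 4 / t ^ 2 := by
      rw [le_div_iff₀ (by positivity), show y ^ 4 = y ^ 2 * y ^ 2 by ring]
      gcongr
    have : 0 ≤ t * y ^ 1 := by positivity
    linarith

theorem lampNorm_two_eq (f : ℤ →₀ ℤ) : lampNorm 2 f = ∑' z, (f z : ℝ) ^ 2 := by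
  simp [lampNorm]

theorem lampNorm_four_eq (f : ℤ →₀ ℤ) : lampNorm 4 f = ∑' z, (f z : ℝ) ^ 4 := by
  simp [lampNorm, Even.pow_abs (⟨2, rfl⟩ : Even 4)]

theorem summable_pow {p : ℕ} (hp : p ≠ 0) (f : ℤ →₀ ℤ) : Summable fun z => (f z : ℝ) ^ p :=
  summable_comp f (fun c => (c : ℝ) ^ p) (by simp [hp])

theorem sum_fin_sq_le_lampNorm (M : ℕ) (f : ℤ →₀ ℤ) (z : ℤ) :
    ∑ u : Fin M, (f (z + (u : ℕ)) : ℝ) ^ 2 ≤ lampNorm 2 f := by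
  have hinj : Function.Injective fun u : Fin M => z + ((u : ℕ) : ℤ) := fun u v h => by
    simp only [add_right_inj, Nat.cast_inj] at h
    exact Fin.ext h
  rw [lampNorm_two_eq, ← Finset.sum_image (f := fun z => (f z : ℝ) ^ 2)
    (g := fun u : Fin M => z + ((u : ℕ) : ℤ)) (s := Finset.univ) hinj.injOn]
  exact (summable_pow two_ne_zero f).sum_le_tsum _ fun _ _ => by positivity

section Symmetric

variable {Ω : Type*} [Fintype Ω] {f : Ω → ℤ →₀ ℤ} {σ : Ω ≃ Ω}

theorem sum_sum_lampNorm_two (hf : ∀ i, f (σ i) = -f i) :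
    ∑ i, ∑ j, lampNorm 2 (f j - f i) = 2 * Fintype.card Ω * ∑ i, lampNorm 2 (f i) := by
  simp only [lampNorm_two_eq]
  rw [← Summable.tsum_finsetSum fun i _ => summable_pow two_ne_zero _, ← tsum_mul_left]
  simp_rw [← Summable.tsum_finsetSum fun j _ => summable_pow two_ne_zero (f j - f _)]
  rw [← Summable.tsum_finsetSum fun i _ => summable_sum fun j _ => summable_pow two_ne_zero _]
  congr 1 with z
  rw [← sum_sum_sub_sq_eq (σ := σ) fun i => by simp [hf]]
  simp

/-- In the term 6(∑ X²)² at each site, one factor is bounded by the uniform `a` and the other is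
summed over sites. Small variance at every site therefore keeps the fourth moment small. -/
theorem sum_sum_lampNorm_four_le (hf : ∀ i, f (σ i) = -f i) {a : ℝ}
    (ha : ∀ z, ∑ i, (f i z : ℝ) ^ 2 ≤ a) :
    ∑ i, ∑ j, lampNorm 4 (f j - f i) ≤
      2 * Fintype.card Ω * ∑ i, lampNorm 4 (f i) + 6 * a * ∑ i, lampNorm 2 (f i) := by
  simp only [lampNorm_two_eq, lampNorm_four_eq]
  have h4 : Summable fun z => ∑ i, (f i z : ℝ) ^ 4 :=
    summable_sum fun i _ => summable_pow four_ne_zero _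
  have h2 : Summable fun z => ∑ i, (f i z : ℝ) ^ 2 :=
    summable_sum fun i _ => summable_pow two_ne_zero _
  have h44 : Summable fun z => ∑ i, ∑ j, ((f j - f i) z : ℝ) ^ 4 :=
    summable_sum fun i _ => summable_sum fun j _ => summable_pow four_ne_zero _
  rw [← Summable.tsum_finsetSum fun i _ => summable_pow four_ne_zero _,
    ← Summable.tsum_finsetSum fun i _ => summable_pow two_ne_zero _, ← tsum_mul_left,
    ← tsum_mul_left, ← (h4.mul_left _).tsum_add (h2.mul_left _)]
  simp_rw [← Summable.tsum_finsetSum fun j _ => summable_pow four_ne_zero (f j - f _)]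
  rw [← Summable.tsum_finsetSum fun i _ => summable_sum fun j _ => summable_pow four_ne_zero _]
  refine h44.tsum_le_tsum (fun z => ?_) ((h4.mul_left _).add (h2.mul_left _))
  have h := sum_sum_sub_pow_four_eq (X := fun i => (f i z : ℝ)) (σ := σ) fun i => by simp [hf]
  simp only [Finsupp.coe_sub, Pi.sub_apply, Int.cast_sub]
  rw [h]
  have h5 : 0 ≤ ∑ i, (f i z : ℝ) ^ 2 := by positivity
  nlinarith [ha z]

end Symmetric

/-- A random element of `ℤ ≀ ℤ`, defined on a finite uniform probability space, whose law is
invariant under changing the signs of all lamps. -/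
structure RandomElement where
  /-- The sample space. -/
  Ω : Type
  [fintype : Fintype Ω]
  [nonempty : Nonempty Ω]
  /-- The random variable. -/
  Z : Ω → WreathZZ
  /-- The involution realising the sign change. -/
  σ : Ω ≃ Ω
  lamps_σ : ∀ i, (Z (σ i)).lamps = -(Z i).lamps
  pos_σ : ∀ i, (Z (σ i)).pos = (Z i).pos

namespace RandomElement

attribute [instance] RandomElement.fintype RandomElement.nonempty

/-- The expectation of `φ (Z)`. -/
noncomputable def expect (R : RandomElement) (φ : WreathZZ → ℝ) : ℝ :=
  (∑ i, φ (R.Z i)) / Fintype.card R.Ω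

theorem card_pos (R : RandomElement) : (0 : ℝ) < Fintype.card R.Ω := by
  exact_mod_cast Fintype.card_pos

theorem sum_eq (R : RandomElement) (φ : WreathZZ → ℝ) :
    ∑ i, φ (R.Z i) = R.expect φ * Fintype.card R.Ω := by
  rw [expect, div_mul_cancel₀ _ R.card_pos.ne']

theorem expect_mono (R : RandomElement) {φ χ : WreathZZ → ℝ} (h : ∀ g, φ g ≤ χ g) :
    R.expect φ ≤ R.expect χ := by
  unfold expect
  gcongr
  exact h _

theorem expect_add (R : RandomElement) (φ χ : WreathZZ → ℝ) :
    R.expect (fun g => φ g + χ g) = R.expect φ + R.expect χ := by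
  simp only [expect, Finset.sum_add_distrib, add_div]

theorem expect_mul (R : RandomElement) (c : ℝ) (φ : WreathZZ → ℝ) :
    R.expect (fun g => c * φ g) = c * R.expect φ := by
  simp only [expect, ← Finset.mul_sum, mul_div_assoc]

theorem expect_div (R : RandomElement) (c : ℝ) (φ : WreathZZ → ℝ) :
    R.expect (fun g => φ g / c) = R.expect φ / c := by
  simp only [expect, ← Finset.sum_div, div_right_comm]

/-- Follow the random element by an independent uniform shift in `[0, M)`. -/
noncomputable def move (R : RandomElement) (M : ℕ) [NeZero M] : RandomElement where
  Ω := R.Ω × Fin M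
  Z p := R.Z p.1 * shift (p.2 : ℕ)
  σ := R.σ.prodCongr (Equiv.refl _)
  lamps_σ p := by simp [lamps_mul_shift, R.lamps_σ]
  pos_σ p := by simp [pos_mul, R.pos_σ]

/-- The quotient of two independent copies of a random element. -/
noncomputable def quot (R : RandomElement) : RandomElement where
  Ω := R.Ω × R.Ω
  Z p := (R.Z p.1)⁻¹ * R.Z p.2
  σ := R.σ.prodCongr R.σ
  lamps_σ p := by
    simp only [lamps_inv_mul, Equiv.prodCongr_apply, Prod.map, R.lamps_σ, R.pos_σ]
    ext z
    simp [Finsupp.equivMapDomain_apply]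
    ring
  pos_σ p := by simp [pos_mul, pos_inv, R.pos_σ]

variable (R : RandomElement) (M : ℕ) [NeZero M]

theorem card_move : (Fintype.card (R.move M).Ω : ℝ) = Fintype.card R.Ω * M := by
  have : Fintype.card (R.move M).Ω = Fintype.card R.Ω * Fintype.card (Fin M) :=
    Fintype.card_prod R.Ω (Fin M)
  rw [this, Fintype.card_fin, Nat.cast_mul]

theorem card_quot : (Fintype.card R.quot.Ω : ℝ) = Fintype.card R.Ω * Fintype.card R.Ω := by
  exact_mod_cast (Fintype.card_prod R.Ω R.Ω)

theorem sum_move (φ : WreathZZ → ℝ) :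
    ∑ p, φ ((R.move M).Z p) = ∑ i, ∑ u : Fin M, φ (R.Z i * shift (u : ℕ)) :=
  Fintype.sum_prod_type (fun p : R.Ω × Fin M => φ (R.Z p.1 * shift (p.2 : ℕ)))

theorem sum_quot (φ : WreathZZ → ℝ) :
    ∑ p, φ (R.quot.Z p) = ∑ i, ∑ j, φ ((R.Z i)⁻¹ * R.Z j) :=
  Fintype.sum_prod_type (fun p : R.Ω × R.Ω => φ ((R.Z p.1)⁻¹ * R.Z p.2))

theorem expect_move_lamps (φ : (ℤ →₀ ℤ) → ℝ) :
    (R.move M).expect (fun g => φ g.lamps) = R.expect fun g => φ g.lamps := by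
  have hM : (M : ℝ) ≠ 0 := NeZero.ne _
  unfold expect
  rw [sum_move R M fun g => φ g.lamps, card_move]
  simp only [lamps_mul_shift, Finset.sum_const, Finset.card_univ, Fintype.card_fin, nsmul_eq_mul,
    ← Finset.mul_sum]
  rw [mul_comm (M : ℝ), mul_div_mul_right _ _ hM]

theorem expect_quot_lampNorm_two :
    R.quot.expect (fun g => lampNorm 2 g.lamps) = 2 * R.expect fun g => lampNorm 2 g.lamps := by
  have hc := R.card_pos
  unfold expect
  rw [sum_quot R fun g => lampNorm 2 g.lamps, card_quot]
  simp only [lamps_inv_mul, lampNorm_equivMapDomain]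
  rw [sum_sum_lampNorm_two R.lamps_σ]
  field_simp

theorem expect_quot_lampNorm_four_le {a : ℝ}
    (ha : ∀ z, R.expect (fun g => (g.lamps z : ℝ) ^ 2) ≤ a) :
    R.quot.expect (fun g => lampNorm 4 g.lamps) ≤ 2 * R.expect (fun g => lampNorm 4 g.lamps) +
      6 * a * R.expect fun g => lampNorm 2 g.lamps := by
  have hc := R.card_pos
  unfold expect
  rw [sum_quot R fun g => lampNorm 4 g.lamps, card_quot]
  simp only [lamps_inv_mul, lampNorm_equivMapDomain]
  have h := sum_sum_lampNorm_four_le R.lamps_σ (a := a * Fintype.card R.Ω) fun z => by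
    rw [R.sum_eq fun g => (g.lamps z : ℝ) ^ 2]
    gcongr
    exact ha z
  rw [div_le_iff₀ (by positivity)]
  refine h.trans (le_of_eq ?_)
  field_simp

/-- Site z of the quotient reads the difference of the lamps at z plus the position of the first
copy. That position contains a uniform shift, so M distinct sites are averaged and one site receives
at most 1/M of the total second moment. -/
theorem expect_quot_move_site_le (z : ℤ) :
    (R.move M).quot.expect (fun g => (g.lamps z : ℝ) ^ 2) ≤
      2 * R.expect (fun g => lampNorm 2 g.lamps) / M := by
  have hc := R.card_pos
  have hM : (0 : ℝ) < M := by exact_mod_cast NeZero.pos M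
  have h1 : ∑ i, ∑ j, lampNorm 2 ((R.Z j).lamps - (R.Z i).lamps) =
      2 * Fintype.card R.Ω * (R.expect (fun g => lampNorm 2 g.lamps) * Fintype.card R.Ω) := by
    rw [sum_sum_lampNorm_two R.lamps_σ, R.sum_eq fun g => lampNorm 2 g.lamps]
  unfold expect at h1 ⊢
  rw [sum_quot _ fun g => (g.lamps z : ℝ) ^ 2, card_quot, card_move]
  have h2 : ∀ i, ∑ j, (((((R.move M).Z i)⁻¹ * (R.move M).Z j).lamps z : ℤ) : ℝ) ^ 2 =
      ∑ j, ∑ _u : Fin M, (((R.Z j).lamps - ((R.move M).Z i).lamps)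
        (z + ((R.move M).Z i).pos) : ℝ) ^ 2 := fun i => by
    rw [sum_move R M fun g => (((((R.move M).Z i)⁻¹ * g).lamps z : ℤ) : ℝ) ^ 2]
    simp [lamps_inv_mul, lamps_mul_shift, Finsupp.equivMapDomain_apply]
  simp only [h2]
  rw [sum_move R M fun g => ∑ j, ∑ _u : Fin M, (((R.Z j).lamps - g.lamps) (z + g.pos) : ℝ) ^ 2]
  have h3 : ∀ i, ∑ u : Fin M, ∑ j, ∑ _u : Fin M, (((R.Z j).lamps -
      (R.Z i * shift (u : ℕ)).lamps) (z + (R.Z i * shift (u : ℕ)).pos) : ℝ) ^ 2 ≤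
      M * ∑ j, lampNorm 2 ((R.Z j).lamps - (R.Z i).lamps) := fun i => by
    simp only [Finset.sum_const, Finset.card_univ, Fintype.card_fin, nsmul_eq_mul,
      ← Finset.mul_sum, lamps_mul_shift, pos_mul, pos_shift, ← add_assoc]
    gcongr
    rw [Finset.sum_comm]
    gcongr
    exact sum_fin_sq_le_lampNorm M _ _
  rw [div_le_iff₀ (by positivity)]
  refine (Finset.sum_le_sum fun i _ => h3 i).trans ?_
  rw [← Finset.mul_sum, h1]
  refine le_of_eq ?_
  field_simp

theorem expect_move_le {ψ : WreathZZ → ℝ} {L : ℝ} {t : ℝ}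
    (hψ : ∀ a, ∀ u : ℕ, u < M → ψ (a * shift u) ≤ (1 + t) * ψ a + L) :
    (R.move M).expect ψ ≤ (1 + t) * R.expect ψ + L := by
  have hc := R.card_pos
  have hM : (0 : ℝ) < M := by exact_mod_cast NeZero.pos M
  unfold expect
  rw [sum_move, card_move, div_le_iff₀ (by positivity)]
  refine (Finset.sum_le_sum fun i _ => Finset.sum_le_sum
    fun (u : Fin M) _ => hψ (R.Z i) u u.isLt).trans ?_
  simp only [Finset.sum_const, Finset.card_univ, Fintype.card_fin, nsmul_eq_mul,
    ← Finset.mul_sum, Finset.sum_add_distrib]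
  refine le_of_eq ?_
  field_simp

theorem expect_quot_le {ψ : WreathZZ → ℝ}
    (hψ : ∀ (Ω : Type) [Fintype Ω] (Z : Ω → WreathZZ),
        ∑ i, ∑ j, ψ ((Z i)⁻¹ * Z j) ≤ 2 * Fintype.card Ω * ∑ i, ψ (Z i)) :
    R.quot.expect ψ ≤ 2 * R.expect ψ := by
  have hc := R.card_pos
  unfold expect
  rw [sum_quot, card_quot, div_le_iff₀ (by positivity)]
  refine (hψ _ _).trans (le_of_eq ?_)
  field_simp

/-- The uniform choice between the two unit lamp moves. -/
noncomputable def coin : RandomElement where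
  Ω := Bool
  Z b := if b then lamp 1 else lamp (-1)
  σ := Equiv.boolNot
  lamps_σ b := by
    ext z
    cases b <;> simp only [Equiv.boolNot_apply, Bool.not_true, Bool.not_false, if_true,
      Bool.false_eq_true, if_false, Finsupp.coe_neg, Pi.neg_apply, lamps_lamp] <;>
      split_ifs <;> rfl
  pos_σ b := by cases b <;> simp

theorem expect_coin (φ : WreathZZ → ℝ) :
    coin.expect φ = (φ (lamp 1) + φ (lamp (-1))) / 2 := by
  have h1 : ∑ i, φ (coin.Z i) = φ (lamp 1) + φ (lamp (-1)) := by
    change ∑ b : Bool, φ (if b then lamp 1 else lamp (-1)) = _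
    simp
  have h2 : Fintype.card coin.Ω = 2 := Fintype.card_bool
  rw [expect, h1, h2]
  norm_num

/-- For an approximately subadditive conditionally negative definite function `ψ`, there are random
elements whose lamps are as spread out as those of the random walk at time `2 ^ k`. -/
theorem exists_spread {ψ : WreathZZ → ℝ} {C s : ℝ} (hs : 0 < s) (hs4 : s ^ 4 = 2) (hC : 0 ≤ C)
    (h1 : ψ (lamp 1) ≤ C) (h2 : ψ (lamp (-1)) ≤ C)
    (hmove : ∀ a, ∀ u M : ℕ, u < M → ∀ t : ℝ, 0 < t →
      ψ (a * shift u) ≤ (1 + t) * ψ a + (1 + t⁻¹) * (C * (M : ℝ) ^ 2))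
    (hquot : ∀ (Ω : Type) [Fintype Ω] (Z : Ω → WreathZZ),
        ∑ i, ∑ j, ψ ((Z i)⁻¹ * Z j) ≤ 2 * Fintype.card Ω * ∑ i, ψ (Z i)) (k : ℕ) :
    ∃ R : RandomElement, R.expect (fun g => lampNorm 2 g.lamps) = s ^ (4 * k) ∧
      (∀ z, R.expect (fun g => (g.lamps z : ℝ) ^ 2) ≤ 2 * s ^ (2 * k)) ∧
      R.expect (fun g => lampNorm 4 g.lamps) ≤ 15 * s ^ (6 * k) ∧
      R.expect ψ ≤ 4 * C * (k + 1) ^ 2 * 2 ^ k := by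
  induction k with
  | zero =>
    refine ⟨coin, ?_, fun z => ?_, ?_, ?_⟩
    · rw [expect_coin]
      simp only [lamp, lampNorm_single two_ne_zero]
      norm_num
    · rw [expect_coin fun g => (g.lamps z : ℝ) ^ 2]
      simp only [lamps_lamp]
      split_ifs <;> norm_num
    · rw [expect_coin]
      simp only [lamp, lampNorm_single four_ne_zero]
      norm_num
    · rw [expect_coin]
      norm_num
      linarith
  | succ k ih =>
    obtain ⟨R, hR2, hRz, hR4, hRψ⟩ := ih
    have hs1 : 1 ≤ s := by
      by_contra! h
      have := pow_le_one₀ hs.le h.le (n := 4)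
      linarith
    have hsk : 1 ≤ s ^ (2 * k) := one_le_pow₀ hs1
    -- M ≈ 2^{k/2} balances two demands: it dilutes the total second moment 2^k to order 2^{k/2} per
    -- site, while the cost M² of the shift stays of order 2^k.
    set M := ⌈s ^ (2 * k)⌉₊ with hM
    have hM0 : 0 < M := Nat.ceil_pos.2 (by positivity)
    have : NeZero M := ⟨hM0.ne'⟩
    have hM1 : s ^ (2 * k) ≤ M := Nat.le_ceil _
    have hM2 : (M : ℝ) ≤ 2 * s ^ (2 * k) := by
      have := Nat.ceil_lt_add_one (a := s ^ (2 * k)) (by positivity)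
      linarith
    have h4k : s ^ (4 * k) = 2 ^ k := by rw [pow_mul, hs4]
    refine ⟨(R.move M).quot, ?_, fun z => ?_, ?_, ?_⟩
    · rw [expect_quot_lampNorm_two, expect_move_lamps R M (lampNorm 2), hR2, mul_add, pow_add,
        mul_one, hs4, mul_comm]
    · refine (R.expect_quot_move_site_le M z).trans ?_
      rw [hR2, div_le_iff₀ (by positivity)]
      have h5 : s ^ (4 * k) = s ^ (2 * k) * s ^ (2 * k) := by ring
      have h6 : s ^ (2 * (k + 1)) = s ^ (2 * k) * s ^ 2 := by ring
      rw [h5, h6]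
      have h7 : 1 ≤ s ^ 2 := one_le_pow₀ hs1
      calc 2 * (s ^ (2 * k) * s ^ (2 * k)) ≤ 2 * (s ^ (2 * k) * 1 * M) := by
            rw [mul_one]; gcongr
        _ ≤ 2 * (s ^ (2 * k) * s ^ 2 * M) := by gcongr
        _ = _ := by ring
    · refine ((R.move M).expect_quot_lampNorm_four_le (a := 2 * s ^ (2 * k)) fun z => ?_).trans ?_
      · rw [expect_move_lamps R M fun f => (f z : ℝ) ^ 2]
        exact hRz z
      · rw [expect_move_lamps R M (lampNorm 4), expect_move_lamps R M (lampNorm 2), hR2]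
        have h5 : 6 * (2 * s ^ (2 * k)) * s ^ (4 * k) = 12 * s ^ (6 * k) := by ring
        have h6 : s ^ (6 * (k + 1)) = s ^ (6 * k) * (s ^ 4 * s ^ 2) := by ring
        -- Since s² = √2, the constant 15 reproduces itself: 2·15 + 12 = 42 = 15·2·1.4.
        have h7 : 1.4 ≤ s ^ 2 := by nlinarith [sq_nonneg s]
        rw [h5, h6, hs4]
        have h8 : 0 < s ^ (6 * k) := by positivity
        nlinarith
    -- With t = 1/(k+1) the polynomial factor closes exactly: (k+1)² + (k+1) + (k+2) = (k+2)².
    · have h5 : (R.move M).expect ψ ≤ _ := R.expect_move_le M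
        (t := ((k : ℝ) + 1)⁻¹) fun a u hu => hmove a u M hu _ (by positivity)
      refine ((R.move M).expect_quot_le hquot).trans ?_
      have h6 : (M : ℝ) ^ 2 ≤ 4 * 2 ^ k := by
        rw [← h4k]
        calc (M : ℝ) ^ 2 ≤ (2 * s ^ (2 * k)) ^ 2 := by gcongr
          _ = _ := by ring
      rw [inv_inv] at h5
      calc 2 * (R.move M).expect ψ
          ≤ 2 * ((1 + ((k : ℝ) + 1)⁻¹) * R.expect ψ + (1 + ((k : ℝ) + 1)) * (C * (M : ℝ) ^ 2)) := by
            gcongr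
        _ ≤ 2 * ((1 + ((k : ℝ) + 1)⁻¹) * (4 * C * (k + 1) ^ 2 * 2 ^ k) +
            (1 + ((k : ℝ) + 1)) * (C * (4 * 2 ^ k))) := by gcongr
        _ = _ := by
            push_cast
            field_simp
            ring

/-- Truncating at t = 6s^k, the fourth moment accounts for at most 15/36 of the second moment. The
rest gives 7/72 · s^{3k}, which exceeds s^{3k}/12. -/
theorem le_expect_lampNorm_one {s : ℝ} (hs : 0 < s) (k : ℕ)
    (h2 : R.expect (fun g => lampNorm 2 g.lamps) = s ^ (4 * k))
    (h4 : R.expect (fun g => lampNorm 4 g.lamps) ≤ 15 * s ^ (6 * k)) :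
    s ^ (3 * k) / 12 ≤ R.expect fun g => lampNorm 1 g.lamps := by
  have ht : 0 < 6 * s ^ k := by positivity
  have h := R.expect_mono fun g => lampNorm_two_le g.lamps ht
  rw [expect_add, expect_mul, expect_div, h2] at h
  have h5 : R.expect (fun g => lampNorm 4 g.lamps) / (6 * s ^ k) ^ 2 ≤ 15 / 36 * s ^ (4 * k) := by
    rw [div_le_iff₀ (by positivity)]
    refine h4.trans (le_of_eq ?_)
    ring
  have h6 : s ^ k * s ^ (3 * k) = s ^ (4 * k) := by ring
  have h7 : s ^ k * (7 / 72 * s ^ (3 * k)) ≤ s ^ k * R.expect fun g => lampNorm 1 g.lamps := by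
    linarith
  have h8 := le_of_mul_le_mul_left h7 (by positivity)
  have : 0 < s ^ (3 * k) := by positivity
  linarith

theorem expect_rpow_le {φ : WreathZZ → ℝ} (hφ : ∀ g, 0 ≤ φ g) {β : ℝ} (hβ : 1 ≤ β) :
    R.expect φ ^ β ≤ R.expect fun g => φ g ^ β := by
  have hc := R.card_pos
  have h := Real.rpow_arith_mean_le_arith_mean_rpow Finset.univ
    (fun _ : R.Ω => (Fintype.card R.Ω : ℝ)⁻¹) (fun i => φ (R.Z i)) (fun _ _ => by positivity)
    (by simp) (fun i _ => hφ _) hβ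
  simpa only [← Finset.mul_sum, expect, div_eq_inv_mul] using h

end RandomElement

open Filter Topology in
/-- An embedding of `ℤ ≀ ℤ` into a Hilbert space has compression exponent at most `2 / 3`. -/
theorem le_two_thirds {S : Set WreathZZ} (hfin : S.Finite) (hinv : ∀ s ∈ S, s⁻¹ ∈ S)
    (hS : Subgroup.closure S = ⊤) {α : ℝ} (h : HasHilbertCompression S α) : α ≤ 2 / 3 := by
  by_contra! hα
  obtain ⟨F, hF, c, hc, hF'⟩ := h
  obtain ⟨m⟩ := nonempty_rightInvariantMean
  obtain ⟨ψ, hψ1, hψ2, hψ3, hψ4⟩ := m.exists_averaged F hF hc.le hF'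
  obtain ⟨C, hC, hCN⟩ := exists_lampNorm_le hfin hinv hS
  set L : ℕ := max (wordLength S (lamp 1)) (max (wordLength S (lamp (-1))) (wordLength S (shift 1)))
    with hL
  have hL1 : wordLength S (lamp 1) ≤ L := by omega
  have hL2 : wordLength S (lamp (-1)) ≤ L := by omega
  have hL3 : wordLength S (shift 1) ≤ L := by omega
  -- With s = 2^{1/4}, the scales 2^{k/2}, 2^{3k/4}, 2^k and 2^{3k/2} are all natural powers of s.
  set s : ℝ := 2 ^ (1 / 4 : ℝ) with hs_def
  have hs : 0 < s := by positivity
  have hs4 : s ^ 4 = 2 := by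
    rw [hs_def, ← Real.rpow_natCast, ← Real.rpow_mul (by norm_num)]
    norm_num
  have key : ∀ k : ℕ, c ^ 2 * (s ^ (3 * k) / 12 / C) ^ (2 * α) ≤
      4 * (L : ℝ) ^ 2 * (k + 1) ^ 2 * 2 ^ k := fun k => by
    obtain ⟨R, hR2, -, hR4, hRψ⟩ := RandomElement.exists_spread (ψ := ψ) (C := (L : ℝ) ^ 2) hs hs4
      (by positivity) ((hψ2 _).trans (by gcongr)) ((hψ2 _).trans (by gcongr))
      (fun a u M hu t ht => (hψ3 a (shift u) t ht).trans (by
        have : wordLength S (shift u) ≤ M * L :=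
          (wordLength_shift_le hinv hS hL3 u).trans (by simpa using Nat.mul_le_mul_right _ hu.le)
        have : (wordLength S (shift u) : ℝ) ≤ M * L := by exact_mod_cast this
        rw [← mul_pow, mul_comm (L : ℝ)]
        gcongr)) hψ4 k
    refine le_trans ?_ hRψ
    have h1 := R.le_expect_lampNorm_one hs k hR2 hR4
    have h2 : s ^ (3 * k) / 12 / C ≤ R.expect fun g => (wordLength S g : ℝ) := by
      rw [div_le_iff₀ hC, mul_comm _ C, ← RandomElement.expect_mul]
      exact h1.trans (R.expect_mono fun g => hCN g)
    calc c ^ 2 * (s ^ (3 * k) / 12 / C) ^ (2 * α)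
        ≤ c ^ 2 * (R.expect fun g => (wordLength S g : ℝ)) ^ (2 * α) := by gcongr
      _ ≤ c ^ 2 * R.expect fun g => (wordLength S g : ℝ) ^ (2 * α) := by
          gcongr
          exact R.expect_rpow_le (fun g => by positivity) (by linarith)
      _ ≤ R.expect ψ := by
          rw [← RandomElement.expect_mul]
          refine R.expect_mono fun g => le_trans (le_of_eq ?_) (hψ1 g)
          rw [mul_comm 2 α, Real.rpow_mul (by positivity)]
          norm_cast
  -- Here q = 2^{3α/2}, which exceeds 2 exactly when α > 2/3. Then k²(2/q)^k tends to 0 and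
  -- contradicts `key`.
  set q : ℝ := s ^ (3 * (2 * α)) with hq
  have hq0 : 0 < q := by positivity
  have hq2 : 2 < q := by
    rw [hq, hs_def, ← Real.rpow_mul (by norm_num)]
    conv_lhs => rw [← Real.rpow_one 2]
    exact Real.rpow_lt_rpow_of_exponent_lt (by norm_num) (by linarith)
  set d : ℝ := c ^ 2 * (12 * C)⁻¹ ^ (2 * α) with hd
  have hd0 : 0 < d := by positivity
  have key2 : ∀ k : ℕ, d * (2 / q) ≤ 4 * (L : ℝ) ^ 2 * (((k + 1 : ℕ) : ℝ) ^ 2 * (2 / q) ^ (k + 1)) :=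
      fun k => by
    have h1 := key k
    have h2 : (s ^ (3 * k) / 12 / C) ^ (2 * α) = (12 * C)⁻¹ ^ (2 * α) * q ^ k := by
      rw [div_div, div_eq_inv_mul, Real.mul_rpow (by positivity) (by positivity), hq,
        ← Real.rpow_natCast s, ← Real.rpow_natCast (s ^ _), ← Real.rpow_mul hs.le,
        ← Real.rpow_mul hs.le]
      congr 2
      push_cast
      ring
    rw [h2, ← mul_assoc, ← hd] at h1
    have h3 : d ≤ 4 * (L : ℝ) ^ 2 * (k + 1) ^ 2 * (2 / q) ^ k := by
      rw [div_pow, ← mul_div_assoc, le_div_iff₀ (by positivity)]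
      exact h1
    calc d * (2 / q) ≤ 4 * (L : ℝ) ^ 2 * (k + 1) ^ 2 * (2 / q) ^ k * (2 / q) := by gcongr
      _ = _ := by push_cast; ring
  have hlim : Tendsto (fun k : ℕ => 4 * (L : ℝ) ^ 2 * (((k + 1 : ℕ) : ℝ) ^ 2 * (2 / q) ^ (k + 1)))
      atTop (𝓝 (4 * (L : ℝ) ^ 2 * 0)) :=
    ((tendsto_add_atTop_iff_nat 1).2 (tendsto_pow_const_mul_const_pow_of_abs_lt_one 2
      (by rw [abs_of_pos (by positivity), div_lt_one hq0]; exact hq2))).const_mul _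
  have := ge_of_tendsto' hlim key2
  have : 0 < d * (2 / q) := by positivity
  linarith

end WreathZZ

/-! ### Maps into L₂ with bounded increments -/

section IntoL2

theorem exists_orthonormal_nat_hilbertL2 : ∃ e : ℕ → HilbertL2, Orthonormal ℝ e := by
  have hμ : ∀ n : ℕ, volume (Set.Ico (n : ℝ) (n + 1)) ≠ ∞ := fun n => by simp
  refine ⟨fun n => indicatorConstLp 2 measurableSet_Ico (hμ n) (1 : ℝ), ?_⟩
  rw [orthonormal_iff_ite]
  intro i j
  rw [L2.real_inner_indicatorConstLp_one_indicatorConstLp_one _ _ (hμ i) (hμ j)]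
  split_ifs with h
  · subst h
    simp
  · have : Set.Ico (i : ℝ) (i + 1) ∩ Set.Ico (j : ℝ) (j + 1) = ∅ := by
      ext x
      simp only [Set.mem_inter_iff, Set.mem_Ico, Set.mem_empty_iff_false, iff_false]
      rintro ⟨⟨h1, h2⟩, h3, h4⟩
      have h5 : (i : ℝ) < j + 1 := h1.trans_lt h4
      have h6 : (j : ℝ) < i + 1 := h3.trans_lt h2
      norm_cast at h5 h6
      omega
    simp [this]

theorem exists_linearIsometry_hilbertL2 (I : Type*) [Countable I] :
    Nonempty (lp (fun _ : I => ℝ) 2 →ₗᵢ[ℝ] HilbertL2) := by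
  obtain ⟨e, he⟩ := exists_orthonormal_nat_hilbertL2
  obtain ⟨φ, hφ⟩ := exists_injective_nat I
  exact ⟨(he.comp φ hφ).orthogonalFamily.linearIsometry⟩

end IntoL2

section BoundedIncrements

variable {G H I J : Type*} [Group G] [Group H]

/-- Right translation by `s` changes the value of `Φ` by a bounded vector of `ℓ²(I)`. -/
def HasBoundedIncrements (Φ : G → I → ℝ) (s : G) : Prop :=
  ∃ C : ℝ, ∀ g, ∀ T : Finset I, ∑ i ∈ T, (Φ (g * s) i - Φ g i) ^ 2 ≤ C

/-- The elements with bounded increments form a subgroup, since the bound is uniform in the base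
point g. -/
theorem hasBoundedIncrements_of_closure {Φ : G → I → ℝ} {S : Set G}
    (hS : Subgroup.closure S = ⊤) (h : ∀ s ∈ S, HasBoundedIncrements Φ s) (s : G) :
    HasBoundedIncrements Φ s := by
  have hs : s ∈ Subgroup.closure S := by simp [hS]
  induction hs using Subgroup.closure_induction with
  | mem x hx => exact h x hx
  | one => exact ⟨0, by simp⟩
  | mul x y _ _ hx hy =>
    obtain ⟨C, hC⟩ := hx
    obtain ⟨D, hD⟩ := hy
    refine ⟨2 * C + 2 * D, fun g T => ?_⟩
    have h1 := hC g T
    have h2 := hD (g * x) T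
    have h3 : ∑ i ∈ T, (Φ (g * (x * y)) i - Φ g i) ^ 2 ≤
        2 * ∑ i ∈ T, (Φ (g * x) i - Φ g i) ^ 2 +
          2 * ∑ i ∈ T, (Φ (g * x * y) i - Φ (g * x) i) ^ 2 := by
      rw [Finset.mul_sum, Finset.mul_sum, ← Finset.sum_add_distrib]
      refine Finset.sum_le_sum fun i _ => ?_
      rw [← mul_assoc]
      nlinarith [sq_nonneg ((Φ (g * x) i - Φ g i) - (Φ (g * x * y) i - Φ (g * x) i))]
    linarith
  | inv x _ hx =>
    obtain ⟨C, hC⟩ := hx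
    refine ⟨C, fun g T => (le_of_eq (Finset.sum_congr rfl fun i _ => ?_)).trans (hC (g * x⁻¹) T)⟩
    rw [inv_mul_cancel_right]
    ring

theorem HasBoundedIncrements.sumElim {Φ : G → I → ℝ} {Ψ : G → J → ℝ} {s : G}
    (hΦ : HasBoundedIncrements Φ s) (hΨ : HasBoundedIncrements Ψ s) :
    HasBoundedIncrements (fun g => Sum.elim (Φ g) (Ψ g)) s := by
  obtain ⟨C, hC⟩ := hΦ
  obtain ⟨D, hD⟩ := hΨ
  refine ⟨C + D, fun g T => ?_⟩
  rw [← Finset.toLeft_disjSum_toRight (u := T), Finset.sum_disjSum]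
  exact add_le_add (hC g _) (hD g _)

theorem HasBoundedIncrements.comp {Φ : H → I → ℝ} (ρ : G →* H) {s : G}
    (h : HasBoundedIncrements Φ (ρ s)) : HasBoundedIncrements (fun g => Φ (ρ g)) s := by
  obtain ⟨C, hC⟩ := h
  exact ⟨C, fun g T => by simpa using hC (ρ g) T⟩

/-- `Φ g` itself need not be square summable, but `Φ g - Φ 1` is, and subtracting `Φ 1` leaves all
differences unchanged. -/
theorem exists_hilbertL2_of_hasBoundedIncrements [Countable I] {Φ : G → I → ℝ}
    (h : ∀ s, HasBoundedIncrements Φ s) :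
    ∃ f : G → HilbertL2, (∀ x y, ∀ T : Finset I, ∑ i ∈ T, (Φ x i - Φ y i) ^ 2 ≤ ‖f x - f y‖ ^ 2) ∧
      ∀ s, ∃ C, ∀ g, ‖f (g * s) - f g‖ ≤ C := by
  obtain ⟨e⟩ := exists_linearIsometry_hilbertL2 I
  have h2 : (2 : ℝ≥0∞).toReal = 2 := by simp
  have h20 : 0 < (2 : ℝ≥0∞).toReal := by simp
  have hmem : ∀ g, Memℓp (Φ g - Φ 1) 2 := fun g => by
    obtain ⟨C, hC⟩ := h g
    refine memℓp_gen' (C := C) fun T => ?_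
    simpa [h2] using hC 1 T
  set v : G → lp (fun _ : I => ℝ) 2 := fun g => ⟨Φ g - Φ 1, hmem g⟩ with hv
  have hvsub : ∀ x y i, (v x - v y) i = Φ x i - Φ y i := fun x y i =>
    sub_sub_sub_cancel_right (Φ x i) (Φ y i) (Φ 1 i)
  have hnorm : ∀ x y, ‖e (v x) - e (v y)‖ = ‖v x - v y‖ := fun x y => by
    rw [← map_sub, e.norm_map]
  refine ⟨fun g => e (v g), fun x y T => ?_, fun s => ?_⟩
  · have := lp.sum_rpow_le_norm_rpow h20 (v x - v y) T
    simpa [hnorm, h2, hvsub] using this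
  · obtain ⟨C, hC⟩ := h s
    have hC0 : 0 ≤ C := by simpa using hC 1 ∅
    refine ⟨√C, fun g => ?_⟩
    rw [hnorm]
    refine lp.norm_le_of_forall_sum_le h20 (Real.sqrt_nonneg _) fun T => ?_
    simpa [h2, hvsub, Real.sq_sqrt hC0] using hC g T

end BoundedIncrements

/-! ### The weights n^β -/

section Weights

/-- By Bernoulli's inequality the increment at n ≥ 1 is at most n^{β−1}, whose square is summable
because β < 1/2. -/
theorem summable_rpow_increments {β : ℝ} (h0 : 0 < β) (h1 : β < 1 / 2) :
    Summable fun n : ℕ => (((n : ℝ) + 1) ^ β - (n : ℝ) ^ β) ^ 2 := by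
  rw [← summable_nat_add_iff 1]
  have hs : Summable fun n : ℕ => ((n + 1 : ℕ) : ℝ) ^ (2 * β - 2) :=
    (summable_nat_add_iff 1).2 (Real.summable_nat_rpow.2 (by linarith))
  refine Summable.of_nonneg_of_le (fun n => sq_nonneg _) (fun n => ?_) hs
  set x : ℝ := ((n + 1 : ℕ) : ℝ) with hx
  have hx0 : 0 < x := by positivity
  have h3 : 0 ≤ (x + 1) ^ β - x ^ β := by
    rw [sub_nonneg]; gcongr; linarith
  have h4 : (x + 1) ^ β ≤ x ^ β * (1 + β * (1 / x)) := by
    have : x + 1 = x * (1 + 1 / x) := by field_simp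
    rw [this, Real.mul_rpow hx0.le (by positivity)]
    gcongr
    have h5 : 0 ≤ 1 / x := by positivity
    exact rpow_one_add_le_one_add_mul_self (by linarith) h0.le (by linarith)
  have h5 : (x + 1) ^ β - x ^ β ≤ x ^ (β - 1) := by
    rw [Real.rpow_sub_one hx0.ne']
    have : x ^ β * (1 + β * (1 / x)) - x ^ β = β * (x ^ β / x) := by field_simp; ring
    have h6 : 0 ≤ x ^ β / x := by positivity
    nlinarith
  calc ((x + 1) ^ β - x ^ β) ^ 2 ≤ (x ^ (β - 1)) ^ 2 := by gcongr
    _ = x ^ (2 * β - 2) := by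
        rw [← Real.rpow_natCast, ← Real.rpow_mul hx0.le]
        congr 1
        push_cast
        ring

/-- As 2β − 1 < 0, each term (j+1)^{2β} is at least R^{2β−1}(j+1), and these add up to at least
R^{2β+1}/2. -/
theorem rpow_le_sum_rpow_sq {β : ℝ} (h0 : 0 < β) (h1 : β < 1 / 2) (R : ℕ) :
    (R : ℝ) ^ (2 * β + 1) / 2 ≤ ∑ j ∈ Finset.range R, (((j : ℝ) + 1) ^ β) ^ 2 := by
  rcases Nat.eq_zero_or_pos R with rfl | hR
  · simp [Real.zero_rpow (by linarith : 2 * β + 1 ≠ 0)]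
  have hR0 : (0 : ℝ) < R := by exact_mod_cast hR
  have h2 : ∀ j ∈ Finset.range R, (R : ℝ) ^ (2 * β - 1) * ((j : ℝ) + 1) ≤
      (((j : ℝ) + 1) ^ β) ^ 2 := fun j hj => by
    have hj : ((j : ℝ) + 1) ≤ R := by exact_mod_cast Finset.mem_range.1 hj
    have h3 : (((j : ℝ) + 1) ^ β) ^ 2 = ((j : ℝ) + 1) ^ (2 * β - 1) * ((j : ℝ) + 1) := by
      rw [← Real.rpow_natCast, ← Real.rpow_mul (by positivity), Real.rpow_sub_one (by positivity),
        div_mul_cancel₀ _ (by positivity)]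
      congr 1
      push_cast
      ring
    rw [h3]
    gcongr ?_ * _
    exact Real.rpow_le_rpow_of_nonpos (by positivity) hj (by linarith)
  refine le_trans ?_ (Finset.sum_le_sum h2)
  rw [← Finset.mul_sum]
  have h4 : ∑ j ∈ Finset.range R, ((j : ℝ) + 1) = R * (R + 1) / 2 := by
    clear h2 hR hR0
    induction R with
    | zero => simp
    | succ n ih => rw [Finset.sum_range_succ, ih]; push_cast; ring
  have h5 : (R : ℝ) ^ (2 * β + 1) = (R : ℝ) ^ (2 * β - 1) * (R * R) := by
    rw [Real.rpow_add_one hR0.ne', Real.rpow_sub_one hR0.ne']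
    field_simp
  rw [h4, h5, mul_div_assoc]
  gcongr
  linarith

end Weights

/-! ### The embedding of `ℤ ≀ ℤ` and the lower bound 2/3 -/

namespace WreathZZ

/-- The reflection of the line, as an endomorphism of `ℤ ≀ ℤ`. -/
noncomputable def reflection : WreathZZ →* WreathZZ where
  toFun g := ⟨g.lamps.equivMapDomain (Equiv.neg ℤ), -g.pos⟩
  map_one' := by
    ext z
    · simp [Finsupp.equivMapDomain_apply, lamps_one]
    · simp [pos_one]
  map_mul' g h := by
    ext z
    · simp [lamps_mul, Finsupp.equivMapDomain_apply]
      congr 1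
      ring
    · simp [pos_mul]
      ring

theorem pos_reflection (g : WreathZZ) : (reflection g).pos = -g.pos := rfl

theorem lamps_reflection (g : WreathZZ) (z : ℤ) : (reflection g).lamps z = g.lamps (-z) := by
  change (g.lamps.equivMapDomain (Equiv.neg ℤ)) z = _
  simp [Finsupp.equivMapDomain_apply]

/-- The restriction of the lamps to `[w, ∞)`. -/
noncomputable def tail (g : WreathZZ) (w : ℤ) : ℤ →₀ ℤ := g.lamps.filter fun v => w ≤ v

open Classical in
/-- The vector that records the tails `tail g w` for `w > g.pos`, with weight
`(w - g.pos) ^ β`. -/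
noncomputable def tailVector (β : ℝ) (g : WreathZZ) (i : ℤ × (ℤ →₀ ℤ)) : ℝ :=
  if i.2 = tail g i.1 then ((i.1 - g.pos).toNat : ℝ) ^ β else 0

/-- Changing the current lamp affects only tails starting at or left of the position, which carry
weight zero. A unit shift keeps all tails and changes the weights by increments of n^β. -/
theorem hasBoundedIncrements_tailVector {β : ℝ} (h0 : 0 < β) (h1 : β < 1 / 2) (s : WreathZZ) :
    HasBoundedIncrements (tailVector β) s := by
  classical
  refine hasBoundedIncrements_of_closure closure_lamp_shift ?_ s
  rintro s (rfl | rfl)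
  · refine ⟨0, fun g T => (Finset.sum_eq_zero fun i _ => ?_).le⟩
    have : tailVector β (g * lamp 1) i = tailVector β g i := by
      unfold tailVector
      rw [pos_mul, pos_lamp, add_zero]
      -- Truncation by `toNat` makes the weight 0^β here, which vanishes because β ≠ 0.
      by_cases hi : i.1 ≤ g.pos
      · rw [Int.toNat_of_nonpos (by omega), Nat.cast_zero, Real.zero_rpow h0.ne', ite_self,
          ite_self]
      · have : tail (g * lamp 1) i.1 = tail g i.1 := by
          ext z
          simp only [tail, Finsupp.filter_apply, lamps_mul_lamp]
          split_ifs <;> first | rfl | omega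
        rw [this]
    rw [this, sub_self]
    norm_num
  · set d : ℕ → ℝ := fun n => (((n : ℝ) + 1) ^ β - (n : ℝ) ^ β) ^ 2 with hd
    have hsum : Summable d := summable_rpow_increments h0 h1
    refine ⟨∑' n, d n, fun g T => ?_⟩
    have hterm : ∀ i, (tailVector β (g * shift 1) i - tailVector β g i) ^ 2 =
        if i.2 = tail g i.1 ∧ g.pos < i.1 then d (i.1 - g.pos - 1).toNat else 0 := fun i => by
      have ht : tail (g * shift 1) i.1 = tail g i.1 := by simp [tail, lamps_mul_shift]
      unfold tailVector
      rw [ht, pos_mul, pos_shift]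
      by_cases h : i.2 = tail g i.1
      · rw [if_pos h, if_pos h]
        by_cases hi : g.pos < i.1
        · rw [if_pos ⟨h, hi⟩]
          obtain ⟨n, hn⟩ := Int.eq_ofNat_of_zero_le (by omega : 0 ≤ i.1 - g.pos - 1)
          rw [show i.1 - (g.pos + 1) = n by omega, show i.1 - g.pos = (n + 1 : ℕ) by
            push_cast; omega, show ((n + 1 : ℕ) : ℤ) - 1 = n by push_cast; ring]
          simp only [Int.toNat_natCast, hd]
          push_cast
          ring
        · rw [if_neg fun h => hi h.2, Int.toNat_of_nonpos (by omega),
            Int.toNat_of_nonpos (by omega)]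
          simp
      · rw [if_neg h, if_neg h, if_neg fun h' => h h'.1]
        norm_num
    simp only [hterm]
    rw [← Finset.sum_filter]
    -- The tail is determined by its starting point, so each n occurs at most once.
    have hinj : Set.InjOn (fun i : ℤ × (ℤ →₀ ℤ) => (i.1 - g.pos - 1).toNat)
        (T.filter fun i => i.2 = tail g i.1 ∧ g.pos < i.1) := by
      rintro ⟨z, t⟩ hz ⟨z', t'⟩ hz' h
      simp only [Finset.coe_filter, Set.mem_ofPred_eq] at hz hz' h
      have : z = z' := by omega
      subst this
      rw [hz.2.1, hz'.2.1]
    rw [← Finset.sum_image (f := d) hinj]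
    exact hsum.sum_le_tsum _ fun n _ => sq_nonneg _

/-- If the lamps of `p` and `q` differ at distance `R` to the right of the position of `p`, their
tail vectors are far apart. -/
theorem exists_tailVector_sub {β : ℝ} (h0 : 0 < β) (h1 : β < 1 / 2) (p q : WreathZZ) (R : ℕ)
    (h : p.lamps (p.pos + R) ≠ q.lamps (p.pos + R)) :
    ∃ T : Finset (ℤ × (ℤ →₀ ℤ)),
      (R : ℝ) ^ (2 * β + 1) / 2 ≤ ∑ i ∈ T, (tailVector β p i - tailVector β q i) ^ 2 := by
  classical
  set e : ℕ → ℤ × (ℤ →₀ ℤ) := fun j => (p.pos + (j + 1), tail p (p.pos + (j + 1))) with he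
  have hinj : Function.Injective e := fun i j hij => by
    have := congrArg Prod.fst hij
    simp only [he] at this
    omega
  refine ⟨(Finset.range R).image e, (rpow_le_sum_rpow_sq h0 h1 R).trans ?_⟩
  rw [Finset.sum_image hinj.injOn]
  refine Finset.sum_le_sum fun j hj => le_of_eq ?_
  have hjR : j < R := Finset.mem_range.1 hj
  -- Every tail starting at most R to the right of p contains the site where p and q differ, so the
  -- vector of q vanishes at these indices.
  have hne : ¬ tail p (p.pos + (j + 1)) = tail q (p.pos + (j + 1)) := fun heq => h <| by
    have := DFunLike.congr_fun heq (p.pos + R)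
    simp only [tail, Finsupp.filter_apply] at this
    rwa [if_pos (by omega), if_pos (by omega)] at this
  simp only [tailVector, he, if_true, if_neg hne]
  rw [show p.pos + ((j : ℤ) + 1) - p.pos = (j + 1 : ℕ) by push_cast; ring, Int.toNat_natCast]
  simp

/-- The total embedding. -/
noncomputable def embeddingVector (β : ℝ) (g : WreathZZ) :
    (Unit ⊕ ℤ) ⊕ ((ℤ × (ℤ →₀ ℤ)) ⊕ (ℤ × (ℤ →₀ ℤ))) → ℝ :=
  Sum.elim (Sum.elim (fun _ => (g.pos : ℝ)) fun z => (g.lamps z : ℝ))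
    (Sum.elim (tailVector β g) (tailVector β (reflection g)))

theorem hasBoundedIncrements_embeddingVector {β : ℝ} (h0 : 0 < β) (h1 : β < 1 / 2)
    (s : WreathZZ) : HasBoundedIncrements (embeddingVector β) s := by
  refine HasBoundedIncrements.sumElim (HasBoundedIncrements.sumElim ?_ ?_)
    (HasBoundedIncrements.sumElim (hasBoundedIncrements_tailVector h0 h1 s)
      ((hasBoundedIncrements_tailVector h0 h1 _).comp reflection))
  · refine ⟨(s.pos : ℝ) ^ 2, fun g T => ?_⟩
    simp only [pos_mul, Int.cast_add, add_sub_cancel_left, Finset.sum_const, nsmul_eq_mul]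
    have h2 : (T.card : ℝ) ≤ 1 := by exact_mod_cast Finset.card_le_univ T
    nlinarith [sq_nonneg (s.pos : ℝ)]
  · refine ⟨lampNorm 2 s.lamps, fun g T => ?_⟩
    have h2 : ∀ z, (((g * s).lamps z : ℝ) - g.lamps z) ^ 2 = (s.lamps (z - g.pos) : ℝ) ^ 2 :=
      fun z => by rw [lamps_mul]; push_cast; ring
    simp only [h2]
    rw [← Finset.sum_image (f := fun z => (s.lamps z : ℝ) ^ 2) (g := fun z => z - g.pos)
      (sub_left_injective.injOn), lampNorm_two_eq]
    exact (summable_pow two_ne_zero _).sum_le_tsum _ fun _ _ => sq_nonneg _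

/-- Cauchy–Schwarz over the 2R + 1 sites of the support range. -/
theorem lampNorm_one_sq_le (f : ℤ →₀ ℤ) (R : ℕ) (hf : ∀ z, f z ≠ 0 → |z| ≤ R) :
    lampNorm 1 f ^ 2 ≤ (2 * R + 1) * lampNorm 2 f := by
  have hsupp : ∀ p ≠ 0, lampNorm p f = ∑ z ∈ Finset.Icc (-R : ℤ) R, |(f z : ℝ)| ^ p :=
    fun p hp => tsum_eq_sum fun z hz => by
      have : f z = 0 := by
        by_contra h
        exact hz (Finset.mem_Icc.2 (abs_le.1 (hf z h)))
      simp [this, hp]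
  rw [hsupp 1 one_ne_zero, hsupp 2 two_ne_zero]
  have h := sq_sum_le_card_mul_sum_sq (s := Finset.Icc (-R : ℤ) R) (f := fun z => |(f z : ℝ)|)
  have hc : ((Finset.Icc (-R : ℤ) R).card : ℝ) = 2 * R + 1 := by
    have : (Finset.Icc (-R : ℤ) R).card = 2 * R + 1 := by rw [Int.card_Icc]; omega
    rw [this]; push_cast; ring
  rw [hc] at h
  simpa only [pow_one] using h

/-- A map to `L₂` with bounded increments that dominates both the walking range and the lamps. -/
theorem exists_embedding {β : ℝ} (h0 : 0 < β) (h1 : β < 1 / 2) :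
    ∃ f : WreathZZ → HilbertL2, (∀ s, ∃ C, ∀ g, ‖f (g * s) - f g‖ ≤ C) ∧
      ∀ p q, ∃ R : ℕ, (∀ z : ℤ, (p⁻¹ * q).lamps z ≠ 0 → |z| ≤ R) ∧ |(p⁻¹ * q).pos| ≤ (R : ℤ) ∧
        (R : ℝ) ^ (2 * β + 1) ≤ 2 * ‖f p - f q‖ ^ 2 ∧
        lampNorm 1 (p⁻¹ * q).lamps ^ 2 ≤ (2 * R + 1) * ‖f p - f q‖ ^ 2 := by
  classical
  obtain ⟨f, hf, hf'⟩ := exists_hilbertL2_of_hasBoundedIncrements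
    (hasBoundedIncrements_embeddingVector h0 h1)
  refine ⟨f, hf', fun p q => ?_⟩
  have hlam : ∀ z, (p⁻¹ * q).lamps z = q.lamps (p.pos + z) - p.lamps (p.pos + z) := fun z => by
    rw [lamps_mul, lamps_inv, pos_inv]
    rw [sub_neg_eq_add, add_comm z]; ring
  have hpos : (p⁻¹ * q).pos = q.pos - p.pos := by rw [pos_mul, pos_inv]; ring
  set h := p⁻¹ * q with hh
  -- R is a maximum that is attained, by the displacement or by a differing lamp; in each case one
  -- block of the embedding detects it.
  set B : Finset ℕ := insert h.pos.natAbs (h.lamps.support.image Int.natAbs) with hB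
  have hBne : B.Nonempty := Finset.insert_nonempty _ _
  set R := B.max' hBne with hR
  have hsupp : ∀ z, h.lamps z ≠ 0 → |z| ≤ R := fun z hz => by
    rw [Int.abs_eq_natAbs]
    exact_mod_cast B.le_max' _ (Finset.mem_insert_of_mem
      (Finset.mem_image_of_mem _ (Finsupp.mem_support_iff.2 hz)))
  have hposR : |h.pos| ≤ R := by
    rw [Int.abs_eq_natAbs]
    exact_mod_cast B.le_max' _ (Finset.mem_insert_self _ _)
  refine ⟨R, hsupp, hposR, ?_, ?_⟩
  · suffices hs : ∃ T, (R : ℝ) ^ (2 * β + 1) / 2 ≤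
        ∑ i ∈ T, (embeddingVector β p i - embeddingVector β q i) ^ 2 by
      obtain ⟨T, hT⟩ := hs
      linarith [hf p q T]
    rcases Finset.mem_insert.1 (B.max'_mem hBne) with hRp | hRl
    · refine ⟨{Sum.inl (Sum.inl ())}, ?_⟩
      have h3 : (R : ℝ) ^ 2 = ((p.pos : ℝ) - q.pos) ^ 2 := by
        rw [hR, hRp, hpos, Nat.cast_natAbs, Int.cast_abs, sq_abs]
        push_cast
        ring
      rw [Finset.sum_singleton]
      simp only [embeddingVector, Sum.elim_inl]
      rw [← h3]
      rcases Nat.eq_zero_or_pos R with hR0 | hR0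
      · simp [hR0, Real.zero_rpow (by linarith : 2 * β + 1 ≠ 0)]
      · have h4 : (1 : ℝ) ≤ R := by exact_mod_cast hR0
        have h5 : (R : ℝ) ^ (2 * β + 1) ≤ (R : ℝ) ^ (2 : ℝ) :=
          Real.rpow_le_rpow_of_exponent_le h4 (by linarith)
        rw [Real.rpow_two] at h5
        nlinarith
    · obtain ⟨z, hz, hzR⟩ := Finset.mem_image.1 hRl
      have hzR : z.natAbs = R := hzR
      have hz := Finsupp.mem_support_iff.1 hz
      rw [hlam, sub_ne_zero] at hz
      rcases le_total 0 z with hz0 | hz0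
      · obtain ⟨T, hT⟩ := exists_tailVector_sub h0 h1 p q R (by
          rw [← hzR, Int.natAbs_of_nonneg hz0]
          exact hz.symm)
        refine ⟨T.map (Function.Embedding.inl.trans Function.Embedding.inr), ?_⟩
        simpa [embeddingVector] using hT
      -- A differing lamp on the left is seen by the tails of the reflected configuration.
      · obtain ⟨T, hT⟩ := exists_tailVector_sub h0 h1 (reflection p) (reflection q) R (by
          rw [← hzR, Int.ofNat_natAbs_of_nonpos hz0, pos_reflection, lamps_reflection,
            lamps_reflection]
          simpa [add_comm] using hz.symm)
        refine ⟨T.map (Function.Embedding.inr.trans Function.Embedding.inr), ?_⟩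
        simpa [embeddingVector] using hT
  · refine (lampNorm_one_sq_le _ R hsupp).trans ?_
    gcongr
    have h3 : lampNorm 2 h.lamps = lampNorm 2 (q.lamps - p.lamps) := by
      rw [hh, lamps_inv_mul, lampNorm_equivMapDomain]
    rw [h3, lampNorm_two_eq]
    refine (summable_pow two_ne_zero _).tsum_le_of_sum_le fun T => ?_
    have h4 := hf p q (T.map (Function.Embedding.inr.trans Function.Embedding.inl))
    refine le_trans (le_of_eq ?_) h4
    simp only [embeddingVector, Finset.sum_map, Function.Embedding.trans_apply,
      Function.Embedding.inr_apply, Function.Embedding.inl_apply, Sum.elim_inl, Sum.elim_inr]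
    refine Finset.sum_congr rfl fun z _ => ?_
    simp only [Finsupp.coe_sub, Pi.sub_apply]
    push_cast
    ring

/-- Needed to absorb the additive constant in the word length bound and to compare powers of N + R.
-/
theorem one_le_lampNorm_add {g : WreathZZ} (hg : g ≠ 1) {R : ℕ} (hR : |g.pos| ≤ R) :
    1 ≤ lampNorm 1 g.lamps + R := by
  by_cases h : g.lamps = 0
  · have hp : g.pos ≠ 0 := fun hp => hg (WreathZZ.ext h hp)
    have h1 : 1 ≤ R := by
      have := Int.one_le_abs hp
      omega
    have h2 : (1 : ℝ) ≤ R := by exact_mod_cast h1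
    linarith [lampNorm_nonneg 1 g.lamps]
  · obtain ⟨z, hz⟩ : ∃ z, g.lamps z ≠ 0 := by
      by_contra! hz
      exact h (Finsupp.ext hz)
    have h1 : (1 : ℝ) ≤ |(g.lamps z : ℝ)| := by exact_mod_cast Int.one_le_abs hz
    have h2 : |(g.lamps z : ℝ)| ^ 1 ≤ lampNorm 1 g.lamps :=
      (summable_lampNorm one_ne_zero g.lamps).le_tsum z fun _ _ => by positivity
    rw [pow_one] at h2
    have : (0 : ℝ) ≤ R := by positivity
    linarith

/-- For a lamp configuration of norm `N` in a range of radius `R`, the two lower bounds for the squared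
distance `D` combine to the exponent `2 α`. -/
theorem rpow_add_le {α N R D : ℝ} (h1 : 1 / 3 < α) (h2 : α < 2 / 3) (hR : 0 ≤ R)
    (hX : 1 ≤ N + R) (hRD : R ^ (3 * α) ≤ 2 * D) (hND : N ^ 2 ≤ (2 * R + 1) * D) :
    (N + R) ^ (2 * α) ≤ 8 * D := by
  set X := N + R with hXdef
  have hX0 : 0 < X := by linarith
  -- X^{2/3} is the critical radius. Above Y/2 the range bound R^{3α} suffices; below it N ≥ X/2,
  -- and N²/(2R+1) is at least of order X^{4/3} ≥ X^{2α}.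
  set Y := X ^ (2 / 3 : ℝ) with hY
  have hY0 : 0 < Y := by positivity
  have hY1 : 1 ≤ Y := Real.one_le_rpow hX (by norm_num)
  have hYX : Y ≤ X := by
    conv_rhs => rw [← Real.rpow_one X]
    exact Real.rpow_le_rpow_of_exponent_le hX (by norm_num)
  rcases le_total (Y / 2) R with h | h
  · have h3 : (Y / 2) ^ (3 * α) ≤ 2 * D := (by gcongr : _ ≤ _).trans hRD
    rw [Real.div_rpow hY0.le (by norm_num), hY, ← Real.rpow_mul hX0.le,
      div_le_iff₀ (by positivity), show (2 / 3 : ℝ) * (3 * α) = 2 * α by ring] at h3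
    have h4 : (2 : ℝ) ^ (3 * α) ≤ 4 := by
      calc (2 : ℝ) ^ (3 * α) ≤ 2 ^ (2 : ℝ) :=
            Real.rpow_le_rpow_of_exponent_le (by norm_num) (by linarith)
        _ = 4 := by norm_num
    have h5 : 0 ≤ 2 * D := le_trans (by positivity) hRD
    nlinarith
  · have hD : 0 ≤ D := by
      have : 0 ≤ 2 * D := le_trans (by positivity) hRD
      linarith
    have h3 : X / 2 ≤ N := by linarith
    have h4 : X ^ 2 / 4 ≤ 2 * Y * D := by
      calc X ^ 2 / 4 = (X / 2) ^ 2 := by ring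
        _ ≤ N ^ 2 := by gcongr
        _ ≤ (2 * R + 1) * D := hND
        _ ≤ 2 * Y * D := by gcongr; linarith
    have h5 : X ^ 2 = Y ^ 2 * Y := by
      rw [hY, ← pow_succ, ← Real.rpow_natCast (X ^ _), ← Real.rpow_mul hX0.le]
      norm_num
    have h6 : X ^ (2 * α) ≤ Y ^ 2 := by
      rw [hY, ← Real.rpow_natCast, ← Real.rpow_mul hX0.le]
      exact Real.rpow_le_rpow_of_exponent_le hX (by push_cast; linarith)
    have h7 : Y * (Y ^ 2) ≤ Y * (8 * D) := by nlinarith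
    exact h6.trans (le_of_mul_le_mul_left h7 hY0)

theorem hasHilbertCompression_of_lt {S : Set WreathZZ} (hfin : S.Finite)
    (hinv : ∀ s ∈ S, s⁻¹ ∈ S) (hS : Subgroup.closure S = ⊤) {α : ℝ} (h1 : 1 / 3 < α)
    (h2 : α < 2 / 3) : HasHilbertCompression S α := by
  -- This β gives 2β + 1 = 3α, and 0 < β < 1/2 is exactly 1/3 < α < 2/3.
  obtain ⟨f, hf, hf'⟩ := exists_embedding (β := (3 * α - 1) / 2) (by linarith) (by linarith)
  obtain ⟨C, hC, hCw⟩ := exists_wordLength_le hinv hS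
  choose K hK using hf
  obtain ⟨L, hL⟩ := (hfin.image K).bddAbove
  set M := max L 1 with hM
  have hM0 : 0 < M := by positivity
  have hlip : ∀ x y, ‖f x - f y‖ ≤ M * wordDist S x y := fun x y => by
    have := le_mul_wordLength hinv hS (N := fun g => ‖f (x * g) - f x‖) (C := M) (by simp)
      (fun g s hs => by
        have h3 : ‖f (x * g * s) - f (x * g)‖ ≤ M :=
          (hK s _).trans ((hL ⟨s, hs, rfl⟩).trans (le_max_left _ _))
        have h4 := norm_sub_le_norm_sub_add_norm_sub (f (x * g * s)) (f (x * g)) (f x)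
        rw [← mul_assoc]
        linarith) (x⁻¹ * y)
    rw [norm_sub_rev]
    simpa [wordDist] using this
  -- The 7 comes from N + 5R + 2 ≤ 7(N + R), valid when N + R ≥ 1, and the 8 from `rpow_add_le`; the
  -- 3 in the final constant is used through 8 ≤ 3².
  have hlow : ∀ x y, ((wordDist S x y : ℝ) ^ α) ^ 2 ≤ ((7 * C) ^ α) ^ 2 * (8 * ‖f x - f y‖ ^ 2) :=
      fun x y => by
    by_cases hxy : x = y
    · subst hxy
      simp [wordDist, wordLength_one, Real.zero_rpow (by linarith : α ≠ 0)]
    obtain ⟨R, hR1, hR2, hR3, hR4⟩ := hf' x y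
    have hX : 1 ≤ lampNorm 1 (x⁻¹ * y).lamps + R :=
      one_le_lampNorm_add (fun h => hxy (inv_mul_eq_one.1 h)) hR2
    have hd : (wordDist S x y : ℝ) ≤ 7 * C * (lampNorm 1 (x⁻¹ * y).lamps + R) := by
      refine (hCw _ R hR1 hR2).trans ?_
      rw [mul_comm 7 C, mul_assoc]
      gcongr
      have : (0 : ℝ) ≤ R := by positivity
      linarith [lampNorm_nonneg 1 (x⁻¹ * y).lamps]
    have h5 := rpow_add_le h1 h2 (Nat.cast_nonneg R) hX
      (by convert hR3 using 2; ring) hR4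
    calc ((wordDist S x y : ℝ) ^ α) ^ 2
        ≤ ((7 * C * (lampNorm 1 (x⁻¹ * y).lamps + R)) ^ α) ^ 2 := by gcongr
      _ = ((7 * C) ^ α) ^ 2 * (lampNorm 1 (x⁻¹ * y).lamps + R) ^ (2 * α) := by
          rw [Real.mul_rpow (by positivity) (by positivity), mul_pow, mul_comm 2 α,
            Real.rpow_mul (by positivity)]
          norm_cast
      _ ≤ _ := by gcongr
  have hsub : ∀ x y, ‖M⁻¹ • f x - M⁻¹ • f y‖ = M⁻¹ * ‖f x - f y‖ := fun x y => by
    rw [← smul_sub, norm_smul, Real.norm_of_nonneg (by positivity)]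
  refine ⟨fun g => M⁻¹ • f g, fun x y => ?_, M⁻¹ * ((7 * C) ^ α * 3)⁻¹, by positivity,
    fun x y => ?_⟩
  · rw [hsub, inv_mul_le_iff₀ hM0]
    exact hlip x y
  · rw [hsub, mul_assoc]
    gcongr
    rw [inv_mul_le_iff₀ (by positivity)]
    refine le_of_sq_le_sq ?_ (by positivity)
    refine (hlow x y).trans ?_
    rw [mul_pow, mul_pow, mul_assoc]
    gcongr
    norm_num

end WreathZZ

theorem mainTheorem1 :
    Group.FG WreathZZ ∧
      ∀ S : Set WreathZZ, S.Finite → (∀ s ∈ S, s⁻¹ ∈ S) → Subgroup.closure S = ⊤ →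
        hilbertCompressionExponent S = 2 / 3 := by
  refine ⟨WreathZZ.group_fg, fun S hfin hinv hS => ?_⟩
  have h23 : ((2 / 3 : ℝ≥0) : ℝ≥0∞) = 2 / 3 := by
    rw [ENNReal.coe_div (by norm_num)]
    norm_num
  refine le_antisymm (iSup₂_le fun α hα => ?_) (ENNReal.le_of_forall_nnreal_lt fun r hr => ?_)
  · rw [← h23]
    have h := WreathZZ.le_two_thirds hfin hinv hS hα
    exact_mod_cast h
  · rw [← h23, ENNReal.coe_lt_coe, ← NNReal.coe_lt_coe] at hr
    push_cast at hr
    -- The construction requires an exponent above 1/3, so small r are raised to 1/2, which only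
    -- increases the supremum's lower bound.
    have hmax : HasHilbertCompression S ((max r (1 / 2) : ℝ≥0) : ℝ) := by
      refine WreathZZ.hasHilbertCompression_of_lt hfin hinv hS ?_ ?_
      · push_cast
        exact lt_max_of_lt_right (by norm_num)
      · push_cast
        exact max_lt hr (by norm_num)
    exact (ENNReal.coe_le_coe.2 (le_max_left r (1 / 2))).trans
      (le_iSup₂_of_le (max r (1 / 2)) hmax le_rfl)
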